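/- Let $\alpha\in(1,2]$ and $\beta\in[-1,1]$. For $\sigma\ge 0$ and $m\in\mathbb R$ let $S_\alpha(\sigma,\beta,m)$ be the stable law with characteristic function $$u\mapsto \exp\bigl(-\sigma^\alpha|u|^\alpha(1-i\beta\,\mathrm{sgn}(u)\tan(\pi\alpha/2))+imu\bigr)\ \text{ if }\alpha<2,\qquad u\mapsto\exp\bigl(-\sigma^2u^2/2+imu\bigr)\ \text{ if }\alpha=2 .$$ Let $(\mathcal L(t))_{t\ge0}$ be an $(\alpha,\beta)$-stable Lévy process, that is, a process with $\mathcal L(0)=0$ a.s., independent and stationary increments and a.s. càdlàg paths such that, for some $\sigma>0$ and $m\in\mathbb R$, $\mathcal L(t)$ has law $S_\alpha(t^{1/\alpha}\sigma,\beta,tm)$ for every $t\ge0$ (the standard one has $\sigma=1$, $m=0$; for $\alpha=2$ it is the standard Wiener process). Let $(S_k)$ be any sequence of real random variables on a probability space, $\mu\in\mathbb R$, and let $a_n>0$ $(n\ge1)$ be of the form $a_n=n^{1/\alpha}L(n)$ with $L$ slowly varying at infinity (positive and measurable on a half-line $[x_0,\infty)$, with $L(cx)/L(x)\to1$ as $x\to\infty$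 for every $c>0$). Suppose that, as $n\to\infty$, $$\frac{S_{[nt]}-[nt]\mu}{a_n}\ \stackrel{d}{\to}\ \mathcal L(t)\quad\text{in } D[0,1],$$ where $D[0,1]$ is the space of real càdlàg functions on $[0,1]$ with the Skorokhod ($J_1$) topology, and that $$\sup_{n\ge1}\frac{\mathbb E|S_n-n\mu|}{a_n}<\infty\qquad\text{and}\qquad \frac{S_n}{n}\to\mu\ \text{ a.s.}$$ Let $f$ be a real function defined on an interval $J\ni\mu$ such that $\mathbb P(S_k/k\in J)=1$ for all $k\ge1$, such that $f(S_k/k)$ is a random variable for all $k\ge1$, and such that $f$ is differentiable at $\mu$ (as a function on $J$). Then $\int_0^1\frac{|\mathcal L(x)|}{x}\,dx<\infty$ a.s. and, as $n\to\infty$, $$\frac1{a_n}\sum_{k=1}^{[nt]}\bigl(f(S_k/k)-f(\mu)\bigr)\ \stackrel{d}{\to}\ f'(\mu)\int_0^t\frac{\mathcal L(x)}{x}\,dx\quad\text{in } D[0,1].$$ -/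

import Mathlib

open MeasureTheory ProbabilityTheory Filter Topology
open scoped unitInterval ENNReal NNReal

namespace StableFCLT

/-- A path `x : T → ℝ` is càdlàg if it is right-continuous and has a finite left limit at every
point.  (At a minimum of `T` the left limit is along the trivial filter, hence no condition.) -/
def IsCadlagPath {T : Type*} [TopologicalSpace T] [Preorder T] (x : T → ℝ) : Prop :=
  ∀ t : T, ContinuousWithinAt x (Set.Ici t) t ∧ ∃ l : ℝ, Tendsto x (𝓝[<] t) (𝓝 l)

/-- The Skorokhod space `D[0,1]` of real càdlàg functions on `[0,1]`.  It is a structure, so that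
it does not inherit the topology of pointwise convergence. -/
@[ext]
structure SkorokhodSpace where
  /-- the underlying function -/
  toFun : I → ℝ
  /-- the underlying function is càdlàg -/
  isCadlag : IsCadlagPath toFun

namespace SkorokhodSpace

instance : CoeFun SkorokhodSpace (fun _ => I → ℝ) := ⟨SkorokhodSpace.toFun⟩

/-- The cost of matching `x` with `y` through the time change `lam`:
the maximum of `sup_t |lam t - t|` and `sup_t |x t - y (lam t)|`. -/
noncomputable def timeChangeCost (x y : SkorokhodSpace) (lam : I ≃o I) : ℝ≥0∞ :=
  (⨆ t : I, edist (lam t) t) ⊔ (⨆ t : I, edist (x t) (y (lam t)))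

/-- The Skorokhod (`J₁`) distance: the infimum of the cost over all time changes, that is, over
all increasing bijections of `[0,1]`. -/
noncomputable instance : EDist SkorokhodSpace :=
  ⟨fun x y => ⨅ lam : I ≃o I, timeChangeCost x y lam⟩

theorem edist_def (x y : SkorokhodSpace) :
    edist x y = ⨅ lam : I ≃o I, timeChangeCost x y lam := rfl

theorem timeChangeCost_refl (x : SkorokhodSpace) :
    timeChangeCost x x (OrderIso.refl I) = 0 := by
  simp [timeChangeCost]

theorem timeChangeCost_symm_le (x y : SkorokhodSpace) (lam : I ≃o I) :
    timeChangeCost y x lam.symm ≤ timeChangeCost x y lam := by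
  unfold timeChangeCost
  refine sup_le_sup (iSup_le fun t => ?_) (iSup_le fun t => ?_)
  · have h := le_iSup (fun s : I => edist (lam s) s) (lam.symm t)
    simpa [edist_comm] using h
  · have h := le_iSup (fun s : I => edist (x s) (y (lam s))) (lam.symm t)
    simpa [edist_comm] using h

theorem timeChangeCost_trans_le (x y z : SkorokhodSpace) (lam nu : I ≃o I) :
    timeChangeCost x z (lam.trans nu) ≤ timeChangeCost x y lam + timeChangeCost y z nu := by
  unfold timeChangeCost
  refine sup_le (iSup_le fun t => ?_) (iSup_le fun t => ?_)
  · calc edist (lam.trans nu t) t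
        ≤ edist (nu (lam t)) (lam t) + edist (lam t) t := edist_triangle _ _ _
      _ = edist (lam t) t + edist (nu (lam t)) (lam t) := add_comm _ _
      _ ≤ _ := add_le_add
          ((le_iSup (fun s : I => edist (lam s) s) t).trans le_sup_left)
          ((le_iSup (fun s : I => edist (nu s) s) (lam t)).trans le_sup_left)
  · calc edist (x t) (z (lam.trans nu t))
        ≤ edist (x t) (y (lam t)) + edist (y (lam t)) (z (nu (lam t))) := edist_triangle _ _ _
      _ ≤ _ := add_le_add
          ((le_iSup (fun s : I => edist (x s) (y (lam s))) t).trans le_sup_right)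
          ((le_iSup (fun s : I => edist (y s) (z (nu s))) (lam t)).trans le_sup_right)

/-- The Skorokhod `J₁` topology on `D[0,1]` is the one of the Skorokhod distance. -/
noncomputable instance : PseudoEMetricSpace SkorokhodSpace where
  edist_self x := by
    rw [edist_def]
    exact le_antisymm ((iInf_le _ (OrderIso.refl I)).trans_eq (timeChangeCost_refl x)) bot_le
  edist_comm x y := by
    rw [edist_def, edist_def]
    refine le_antisymm (le_iInf fun lam => ?_) (le_iInf fun lam => ?_)
    · exact (iInf_le _ lam.symm).trans (timeChangeCost_symm_le y x lam)
    · exact (iInf_le _ lam.symm).trans (timeChangeCost_symm_le x y lam)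
  edist_triangle x y z := by
    rw [edist_def, edist_def, edist_def]
    exact ENNReal.le_iInf_add_iInf fun lam nu =>
      (iInf_le _ (lam.trans nu)).trans (timeChangeCost_trans_le x y z lam nu)

/-- `D[0,1]` carries the Borel σ-algebra of the Skorokhod topology. -/
noncomputable instance : MeasurableSpace SkorokhodSpace := borel SkorokhodSpace

instance : BorelSpace SkorokhodSpace := ⟨rfl⟩

end SkorokhodSpace

/-- Convergence in distribution in `D[0,1]` of processes `(X n t)_{t ∈ [0,1]}` to a process
`(Y t)_{t ∈ [0,1]}`: almost all paths of these processes are càdlàg, and the corresponding random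
elements of `D[0,1]` converge in distribution, i.e. their laws converge weakly on `D[0,1]` with the
Skorokhod topology. -/
def TendstoInDistributionD {Ω Ω' : Type*} [MeasurableSpace Ω] [MeasurableSpace Ω']
    (X : ℕ → I → Ω → ℝ) (P : Measure Ω) [IsProbabilityMeasure P]
    (Y : I → Ω' → ℝ) (Q : Measure Ω') [IsProbabilityMeasure Q] : Prop :=
  ∃ (X' : ℕ → Ω → SkorokhodSpace) (Y' : Ω' → SkorokhodSpace),
    (∀ n, ∀ᵐ ω ∂P, ∀ t : I, X' n ω t = X n t ω) ∧
    (∀ᵐ ω ∂Q, ∀ t : I, Y' ω t = Y t ω) ∧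
    TendstoInDistribution X' atTop Y' (fun _ => P) Q

/-- A function `L` is slowly varying (at infinity) if on some half-line `[x₀, ∞)` it is positive
and measurable, and `L (c x) / L x → 1` as `x → ∞` for every `c > 0`. -/
def SlowlyVarying (L : ℝ → ℝ) : Prop :=
  (∃ x₀ : ℝ, (∀ x ≥ x₀, 0 < L x) ∧ Measurable ((Set.Ici x₀).domRestrict L)) ∧
    ∀ c : ℝ, 0 < c → Tendsto (fun x => L (c * x) / L x) atTop (𝓝 1)

/-- The characteristic function of the stable law `S_α(s, β, m)` of index `α ≠ 1`, with scale `s`,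
skewness `β` and location `m`.  For `α = 2` the law is normalized to be the Gaussian law with mean
`m` and variance `s ^ 2`. -/
noncomputable def stableCharFun (α s β m u : ℝ) : ℂ :=
  if α = 2 then
    Complex.exp (-((s ^ 2 * u ^ 2 / 2 : ℝ) : ℂ) + Complex.I * ((m * u : ℝ) : ℂ))
  else
    Complex.exp (-((s ^ α * |u| ^ α : ℝ) : ℂ) *
        (1 - Complex.I * ((β * SignType.sign u * Real.tan (Real.pi * α / 2) : ℝ) : ℂ))
      + Complex.I * ((m * u : ℝ) : ℂ))

/-- `X` is an `(α, β)`-stable Lévy process (`α ≠ 1`) with scale `s` and drift `m`: it starts at `0`,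
has independent and stationary increments and càdlàg paths, and `X t` has the stable law
`S_α(t ^ (1/α) s, β, t m)`. -/
structure IsStableLevyProcess {Ω : Type*} [MeasurableSpace Ω] (α β s m : ℝ)
    (X : ℝ≥0 → Ω → ℝ) (P : Measure Ω) : Prop where
  aemeasurable : ∀ t, AEMeasurable (X t) P
  start_zero : ∀ᵐ ω ∂P, X 0 ω = 0
  indep_increments : HasIndepIncrements X P
  stationary_increments : ∀ r h : ℝ≥0,
    IdentDistrib (fun ω => X (r + h) ω - X r ω) (X h) P P
  stable_marginals : ∀ (t : ℝ≥0) (u : ℝ),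
    charFun (P.map (X t)) u = stableCharFun α ((t : ℝ) ^ (1 / α) * s) β (t * m) u
  cadlag_paths : ∀ᵐ ω ∂P, IsCadlagPath (fun t => X t ω)

end StableFCLT

/-! Write `y_k = S_k - kμ` and let `V_n(s) = y_{[ns]} / a_n`. Linearizing `f` at `μ` gives `f(S_k/k)
- f(μ) = f'(μ) y_k/k + r_k`. The normalized sum of the `y_k/k` is a Riemann sum of `∫ V_n(s)/s ds`,
so the theorem would be a continuous mapping argument if the kernel `1/s` were not singular at `0`.

With `1/s` cut off at a level `ε`, the map `y ↦ ∫₀ᵗ y(s)/s ds` is continuous on `D[0,1]`: `J₁`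
convergence gives a local uniform bound and pointwise convergence off a countable set, hence
weighted `L¹` convergence (`continuous_weightedPrimitive`). The cut-off is negligible uniformly in
`n`: `E|y_k| = O(a_k)`, and Potter's bound yields `∑_{k ≤ m} a_k/k ≤ C (m/n)^{ρ/2} a_n` with `ρ =
1/α` (`exists_sum_div_le`), so the indices `k ≤ εn` contribute `O(ε^{ρ/2})` in mean. The same moment
bound, carried to the limit by weak convergence and Fatou, makes `L(x)/x` integrable
(`ae_intervalIntegrable_extend_mul_inv`), and `tendstoInDistribution_of_approx` then lets `ε → 0`.

For the remainder, the law of large numbers and differentiability give `r_k = o(|y_k|/k)` almost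
surely, but no bound on `E|r_k|`. It is enough that the weights `a_n⁻¹ ∑ |y_k|/k` are bounded in
mean: averages of an almost surely vanishing sequence against them tend to zero in probability
(`eventually_measure_weighted_sum_le`). The Riemann sum error, of relative size `1/k`, is handled in
the same way. -/

namespace StableFCLT

/-! ### Slow variation: uniform convergence, Potter's bound and sums of the normalizers. -/

/-- **Uniform convergence theorem** for additively slowly varying functions. -/
theorem exists_forall_abs_sub_le_of_tendsto_sub {h : ℝ → ℝ} (hm : Measurable h)
    (hlim : ∀ u, Tendsto (fun x => h (x + u) - h x) atTop (𝓝 0)) {ε : ℝ} (hε : 0 < ε) :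
    ∃ x₀, ∀ x ≥ x₀, ∀ u ∈ Set.Icc (0 : ℝ) 1, |h (x + u) - h x| ≤ ε := by
  by_contra! hcon
  choose x hx u hu hxu using fun n : ℕ => hcon n
  have hxt : Tendsto x atTop atTop := tendsto_atTop_mono hx tendsto_natCast_atTop_atTop
  -- The shifts that are good from index `N` on; since `y → ∞`, these sets increase to the whole
  -- line with `N`.
  let G : (ℕ → ℝ) → ℕ → Set ℝ := fun y N => ⋂ m ≥ N, {v | |h (y m + v) - h (y m)| < ε / 2}
  have hGm : ∀ y N, MeasurableSet (G y N) := fun y N =>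
    MeasurableSet.iInter fun m => MeasurableSet.iInter fun _ =>
      measurableSet_lt (by fun_prop) measurable_const
  have hGmono : ∀ y, Monotone (G y) := by
    intro y i j hij v hv
    simp only [G, Set.mem_iInter] at hv ⊢
    exact fun m hm => hv m (hij.trans hm)
  have hGU : ∀ y : ℕ → ℝ, Tendsto y atTop atTop → ⋃ N, G y N = Set.univ := by
    intro y hy
    refine Set.eq_univ_of_forall fun v => ?_
    have := ((hlim v).comp hy).eventually (Metric.ball_mem_nhds 0 (half_pos hε))
    obtain ⟨N, hN⟩ := eventually_atTop.1 this
    refine Set.mem_iUnion.2 ⟨N, Set.mem_iInter.2 fun m => Set.mem_iInter.2 fun hm => ?_⟩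
    simpa [Real.dist_eq] using hN m hm
  have hGlim : ∀ (y : ℕ → ℝ) (s : Set ℝ), Tendsto y atTop atTop →
      Tendsto (fun N => volume (G y N ∩ s)) atTop (𝓝 (volume s)) := by
    intro y s hy
    have := tendsto_measure_iUnion_atTop (μ := volume) (s := fun N => G y N ∩ s)
      fun i j hij => Set.inter_subset_inter_left _ (hGmono y hij)
    rwa [← Set.iUnion_inter, hGU y hy, Set.univ_inter] at this
  have hyt : Tendsto (fun n => x n + u n) atTop atTop :=
    tendsto_atTop_mono (fun n => by linarith [(hu n).1]) hxt
  have h1 : ∀ᶠ N in atTop, ENNReal.ofReal (3 / 2) < volume (G x N ∩ Set.Icc 0 2) := by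
    refine (hGlim x _ hxt).eventually (lt_mem_nhds ?_)
    rw [Real.volume_Icc]
    exact (ENNReal.ofReal_lt_ofReal_iff (by norm_num)).2 (by norm_num)
  have h2 : ∀ᶠ N in atTop, ENNReal.ofReal (1 / 2) <
      volume (G (fun n => x n + u n) N ∩ Set.Icc 0 1) := by
    refine (hGlim _ _ hyt).eventually (lt_mem_nhds ?_)
    rw [Real.volume_Icc]
    exact (ENNReal.ofReal_lt_ofReal_iff (by norm_num)).2 (by norm_num)
  obtain ⟨N, hN1, hN2⟩ := (h1.and h2).exists
  -- Translated by `u N ∈ [0,1]`, the second set also lies in `[0,2]`. The measures exceed `3/2` and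
  -- `1/2`, so the two sets meet, and `x N + w` is then compared with both `x N` and `x N + u N`.
  rw [← measure_preimage_add_right volume (-u N)] at hN2
  obtain ⟨w, ⟨hw1, -⟩, hw2, -⟩ := nonempty_inter_of_measure_lt_add (μ := volume)
    (s := G x N ∩ Set.Icc 0 2)
    (t := (fun w => w + -u N) ⁻¹' (G (fun n => x n + u n) N ∩ Set.Icc 0 1)) (u := Set.Icc 0 2)
    ((measurable_add_const (-u N)) ((hGm _ _).inter measurableSet_Icc)) Set.inter_subset_right
    (fun w hw => ⟨by linarith [hw.2.1, (hu N).1], by linarith [hw.2.2, (hu N).2]⟩)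
    (by
      refine lt_of_le_of_lt (le_of_eq ?_) (ENNReal.add_lt_add hN1 hN2)
      rw [Real.volume_Icc, ← ENNReal.ofReal_add (by norm_num) (by norm_num)]
      norm_num)
  simp only [G, Set.mem_iInter] at hw1 hw2
  have e1 := hw1 N le_rfl
  have e2 := hw2 N le_rfl
  have e3 := hxu N
  simp only [Set.mem_ofPred_eq] at e1 e2
  rw [show x N + u N + (w + -u N) = x N + w by ring] at e2
  have := abs_sub_le (h (x N + u N)) (h (x N + w)) (h (x N))
  rw [abs_sub_comm (h (x N + u N)) (h (x N + w))] at this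
  linarith

/-- A shift by `u` splits into `⌊u⌋₊` unit steps and a fractional one, each costing at most `ε`. -/
theorem exists_forall_abs_sub_le_mul_of_tendsto_sub {h : ℝ → ℝ} (hm : Measurable h)
    (hlim : ∀ u, Tendsto (fun x => h (x + u) - h x) atTop (𝓝 0)) {ε : ℝ} (hε : 0 < ε) :
    ∃ x₀, ∀ x ≥ x₀, ∀ u ≥ 0, |h (x + u) - h x| ≤ ε * (u + 1) := by
  obtain ⟨x₀, hx₀⟩ := exists_forall_abs_sub_le_of_tendsto_sub hm hlim hε
  have key : ∀ (n : ℕ) (x : ℝ), x₀ ≤ x → ∀ u ∈ Set.Icc (0 : ℝ) 1,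
      |h (x + (n + u)) - h x| ≤ ε * (n + 1) := by
    intro n
    induction n with
    | zero => intro x hx u hu; simpa using hx₀ x hx u hu
    | succ n ih =>
      intro x hx u hu
      have h1 := hx₀ x hx 1 ⟨zero_le_one, le_rfl⟩
      have h2 := ih (x + 1) (by linarith) u hu
      have h3 := abs_sub_le (h (x + ((n + 1 : ℕ) + u))) (h (x + 1)) (h x)
      rw [show x + 1 + (n + u) = x + ((n + 1 : ℕ) + u) by push_cast; ring] at h2
      push_cast at h2 h3 ⊢
      linarith
  refine ⟨x₀, fun x hx u hu => ?_⟩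
  have h1 := key ⌊u⌋₊ x hx (u - ⌊u⌋₊) ⟨by linarith [Nat.floor_le hu],
    by linarith [Nat.lt_floor_add_one u]⟩
  rw [add_sub_cancel] at h1
  exact h1.trans (mul_le_mul_of_nonneg_left (by linarith [Nat.floor_le hu]) hε.le)

/-- **Potter's bound**. -/
theorem SlowlyVarying.exists_le_mul_rpow {L : ℝ → ℝ} (hL : SlowlyVarying L) {ε : ℝ} (hε : 0 < ε) :
    ∃ x₀ > 0, ∀ x ≥ x₀, ∀ y ≥ x, L x ≤ Real.exp ε * (y / x) ^ ε * L y := by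
  obtain ⟨⟨x₁, hpos, hmeas⟩, hlim⟩ := hL
  -- `L` is positive and measurable only on `[x₁, ∞)`; the maximum keeps the argument there and is
  -- invisible for large `u`.
  let h : ℝ → ℝ := fun u => Real.log (L (max (Real.exp u) x₁))
  have hhm : Measurable h := by
    have : Measurable fun u : ℝ => (Set.Ici x₁).domRestrict L
        ⟨max (Real.exp u) x₁, Set.mem_Ici.2 (le_max_right _ _)⟩ :=
      hmeas.comp (Measurable.subtype_mk (by fun_prop))
    exact Real.measurable_log.comp this
  have hexp : ∀ v : ℝ, ∀ᶠ u in atTop, x₁ ≤ Real.exp (u + v) := fun v =>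
    (Real.tendsto_exp_atTop.comp (tendsto_atTop_add_const_right _ v tendsto_id)).eventually_ge_atTop x₁
  have hhlim : ∀ v, Tendsto (fun u => h (u + v) - h u) atTop (𝓝 0) := by
    intro v
    have h1 := ((hlim (Real.exp v) (Real.exp_pos v)).comp Real.tendsto_exp_atTop).log one_ne_zero
    rw [Real.log_one] at h1
    refine h1.congr' ?_
    filter_upwards [hexp v, hexp 0] with u hu1 hu2
    rw [add_zero] at hu2
    have e : Real.exp v * Real.exp u = Real.exp (u + v) := by rw [Real.exp_add, mul_comm]
    simp only [Function.comp_apply, h, e, max_eq_left hu1, max_eq_left hu2]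
    exact Real.log_div (hpos _ hu1).ne' (hpos _ hu2).ne'
  obtain ⟨u₀, hu₀⟩ := exists_forall_abs_sub_le_mul_of_tendsto_sub hhm hhlim hε
  refine ⟨max (Real.exp u₀) x₁, lt_max_of_lt_left (Real.exp_pos _), fun x hx y hy => ?_⟩
  have hx0 : 0 < x := (Real.exp_pos u₀).trans_le ((le_max_left _ _).trans hx)
  have hy0 : 0 < y := hx0.trans_le hy
  have hx1 : x₁ ≤ x := (le_max_right _ _).trans hx
  have h1 := hu₀ (Real.log x) ((Real.le_log_iff_exp_le hx0).2 ((le_max_left _ _).trans hx))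
    (Real.log y - Real.log x) (sub_nonneg.2 (Real.log_le_log hx0 hy))
  rw [add_sub_cancel] at h1
  simp only [h, Real.exp_log hx0, Real.exp_log hy0, max_eq_left hx1,
    max_eq_left (hx1.trans hy)] at h1
  have h2 : Real.log (L x) ≤ ε + ε * Real.log (y / x) + Real.log (L y) := by
    rw [Real.log_div hy0.ne' hx0.ne']
    nlinarith [neg_abs_le (Real.log (L y) - Real.log (L x))]
  have hd : 0 < y / x := div_pos hy0 hx0
  rw [← Real.exp_log (hpos x hx1), ← Real.exp_log (hpos y (hx1.trans hy)),
    Real.rpow_def_of_pos hd, ← Real.exp_add, ← Real.exp_add, Real.exp_le_exp]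
  linarith

/-- Potter's bound with exponent `ρ/2` spends half of the power `(k/n)^ρ` on the slowly varying
factor. The finitely many indices below the Potter threshold go into the constant. -/
theorem exists_le_mul_div_rpow_mul {L : ℝ → ℝ} (hL : SlowlyVarying L) {ρ : ℝ} (hρ : 0 < ρ)
    {a : ℕ → ℝ} (ha : ∀ n : ℕ, 1 ≤ n → 0 < a n ∧ a n = (n : ℝ) ^ ρ * L n) :
    ∃ C > 0, ∀ k n : ℕ, 1 ≤ k → k ≤ n → a k ≤ C * ((k : ℝ) / n) ^ (ρ / 2) * a n := by
  obtain ⟨x₀, hx₀, hP⟩ := hL.exists_le_mul_rpow (half_pos hρ)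
  have hlarge : ∀ k n : ℕ, x₀ ≤ k → k ≤ n →
      a k ≤ Real.exp (ρ / 2) * ((k : ℝ) / n) ^ (ρ / 2) * a n := by
    intro k n hk hkn
    have hk0 : (0 : ℝ) < k := hx₀.trans_le hk
    have hn0 : (0 : ℝ) < n := hk0.trans_le (by exact_mod_cast hkn)
    have hk1 : 1 ≤ k := by exact_mod_cast hk0
    rw [(ha k hk1).2, (ha n (hk1.trans hkn)).2]
    have h1 := mul_le_mul_of_nonneg_left (hP k hk n (by exact_mod_cast hkn))
      (Real.rpow_nonneg hk0.le ρ)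
    refine h1.trans (le_of_eq ?_)
    have e1 : (k : ℝ) ^ ρ = (k : ℝ) ^ (ρ / 2) * (k : ℝ) ^ (ρ / 2) := by
      rw [← Real.rpow_add hk0, add_halves]
    have e2 : (n : ℝ) ^ ρ = (n : ℝ) ^ (ρ / 2) * (n : ℝ) ^ (ρ / 2) := by
      rw [← Real.rpow_add hn0, add_halves]
    rw [Real.div_rpow hn0.le hk0.le, Real.div_rpow hk0.le hn0.le, e1, e2]
    have := (Real.rpow_pos_of_pos hk0 (ρ / 2)).ne'
    have := (Real.rpow_pos_of_pos hn0 (ρ / 2)).ne'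
    field_simp
  obtain ⟨K, hK⟩ : ∃ K : ℕ, max x₀ 1 ≤ K := exists_nat_ge _
  have hK1 : 1 ≤ K := by exact_mod_cast (le_max_right _ _).trans hK
  have hKx : x₀ ≤ K := (le_max_left _ _).trans hK
  obtain ⟨A, hA1, hA⟩ : ∃ A ≥ 1, ∀ k n : ℕ, 1 ≤ k → k ≤ K → 1 ≤ n → n ≤ K → a k ≤ A * a n := by
    refine ⟨1 + ∑ k ∈ Finset.Icc 1 K, ∑ n ∈ Finset.Icc 1 K, a k / a n,
      le_add_of_nonneg_right (Finset.sum_nonneg fun k hk => Finset.sum_nonneg fun n hn =>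
        div_nonneg (ha k (Finset.mem_Icc.1 hk).1).1.le (ha n (Finset.mem_Icc.1 hn).1).1.le), ?_⟩
    intro k n hk1 hkK hn1 hnK
    have hpos : ∀ k ∈ Finset.Icc 1 K, ∀ n ∈ Finset.Icc 1 K, 0 ≤ a k / a n := fun k hk n hn =>
      div_nonneg (ha k (Finset.mem_Icc.1 hk).1).1.le (ha n (Finset.mem_Icc.1 hn).1).1.le
    have hk : k ∈ Finset.Icc 1 K := Finset.mem_Icc.2 ⟨hk1, hkK⟩
    have hn : n ∈ Finset.Icc 1 K := Finset.mem_Icc.2 ⟨hn1, hnK⟩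
    have h1 : a k / a n ≤ ∑ n ∈ Finset.Icc 1 K, a k / a n :=
      Finset.single_le_sum (f := fun n => a k / a n) (hpos k hk) hn
    have h2 : ∑ n ∈ Finset.Icc 1 K, a k / a n ≤
        ∑ k ∈ Finset.Icc 1 K, ∑ n ∈ Finset.Icc 1 K, a k / a n :=
      Finset.single_le_sum (f := fun k => ∑ n ∈ Finset.Icc 1 K, a k / a n)
        (fun k hk => Finset.sum_nonneg (hpos k hk)) hk
    rw [← div_le_iff₀ (ha n hn1).1]
    linarith
  have hE : 1 ≤ Real.exp (ρ / 2) := Real.one_le_exp (half_pos hρ).le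
  have hK1' : (1 : ℝ) ≤ K := by exact_mod_cast hK1
  have hKp : 1 ≤ (K : ℝ) ^ (ρ / 2) := Real.one_le_rpow hK1' (half_pos hρ).le
  refine ⟨A * Real.exp (ρ / 2) * (K : ℝ) ^ (ρ / 2), by positivity, fun k n hk hkn => ?_⟩
  have hn := hk.trans hkn
  have hk' : (1 : ℝ) ≤ k := by exact_mod_cast hk
  have hn' : (1 : ℝ) ≤ n := by exact_mod_cast hn
  have hr : 0 ≤ ((k : ℝ) / n) ^ (ρ / 2) := by positivity
  -- For `k < K` the large-index bound is applied at `K` instead; `k ≥ 1` turns `K/n` back into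
  -- `k/n` at the price of a constant.
  have hKn : ((K : ℝ) / n) ^ (ρ / 2) ≤ (K : ℝ) ^ (ρ / 2) * ((k : ℝ) / n) ^ (ρ / 2) := by
    rw [← Real.mul_rpow (by positivity) (by positivity)]
    refine Real.rpow_le_rpow (by positivity) ?_ (half_pos hρ).le
    rw [← mul_div_assoc]
    gcongr
    nlinarith
  have han := (ha n hn).1.le
  by_cases hkK : K ≤ k
  · refine (hlarge k n (hKx.trans (by exact_mod_cast hkK)) hkn).trans ?_
    gcongr
    calc Real.exp (ρ / 2) = 1 * Real.exp (ρ / 2) * 1 := by ring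
      _ ≤ _ := by gcongr
  · push Not at hkK
    by_cases hnK : K ≤ n
    · calc a k ≤ A * a K := hA k K hk hkK.le hK1 le_rfl
        _ ≤ A * (Real.exp (ρ / 2) * ((K : ℝ) / n) ^ (ρ / 2) * a n) := by
            gcongr
            exact hlarge K n hKx hnK
        _ ≤ A * (Real.exp (ρ / 2) * ((K : ℝ) ^ (ρ / 2) * ((k : ℝ) / n) ^ (ρ / 2)) * a n) := by
            gcongr
        _ = _ := by ring
    · push Not at hnK
      have hone : 1 ≤ ((K : ℝ) / n) ^ (ρ / 2) :=
        Real.one_le_rpow ((one_le_div (by positivity)).2 (by exact_mod_cast hnK.le))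
          (half_pos hρ).le
      calc a k ≤ A * a n := hA k n hk hkK.le hn hnK.le
        _ = A * 1 * 1 * a n := by ring
        _ ≤ A * Real.exp (ρ / 2) * ((K : ℝ) ^ (ρ / 2) * ((k : ℝ) / n) ^ (ρ / 2)) * a n := by
            gcongr
            exact hone.trans hKn
        _ = _ := by ring

/-- Bernoulli's inequality for the exponent `p ≤ 1` bounds each term by an increment of `m ^ p / p`,
and the increments telescope. -/
theorem sum_Icc_rpow_sub_one_le {p : ℝ} (hp : 0 < p) (hp1 : p ≤ 1) (m : ℕ) :
    ∑ k ∈ Finset.Icc 1 m, (k : ℝ) ^ (p - 1) ≤ (m : ℝ) ^ p / p := by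
  induction m with
  | zero => simp [Real.zero_rpow hp.ne']
  | succ m ih =>
    rw [Finset.sum_Icc_succ_top (by omega)]
    have hm : (0 : ℝ) < (m + 1 : ℕ) := by positivity
    have hx : -1 ≤ -((m + 1 : ℕ) : ℝ)⁻¹ := by
      rw [neg_le_neg_iff]
      exact inv_le_one_of_one_le₀ (by push_cast; linarith [(Nat.cast_nonneg m : (0 : ℝ) ≤ m)])
    have h1 := rpow_one_add_le_one_add_mul_self hx hp.le hp1
    have h2 : (m : ℝ) ^ p = ((m + 1 : ℕ) : ℝ) ^ p * (1 + -((m + 1 : ℕ) : ℝ)⁻¹) ^ p := by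
      rw [← Real.mul_rpow hm.le (by linarith)]
      congr 1
      field_simp
      push_cast
      ring
    have h3 : ((m + 1 : ℕ) : ℝ) ^ (p - 1) = ((m + 1 : ℕ) : ℝ) ^ p * ((m + 1 : ℕ) : ℝ)⁻¹ := by
      rw [Real.rpow_sub_one hm.ne', div_eq_mul_inv]
    have h4 := mul_le_mul_of_nonneg_left h1 (Real.rpow_nonneg hm.le p)
    rw [← h2] at h4
    have h5 : ((m + 1 : ℕ) : ℝ) ^ (p - 1) ≤
        ((m + 1 : ℕ) : ℝ) ^ p / p - (m : ℝ) ^ p / p := by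
      rw [← sub_div, le_div_iff₀ hp, h3]
      linarith
    linarith

theorem exists_sum_div_le {L : ℝ → ℝ} (hL : SlowlyVarying L) {ρ : ℝ} (hρ : 0 < ρ) (hρ1 : ρ ≤ 1)
    {a : ℕ → ℝ} (ha : ∀ n : ℕ, 1 ≤ n → 0 < a n ∧ a n = (n : ℝ) ^ ρ * L n) :
    ∃ C > 0, ∀ m n : ℕ, 1 ≤ n → m ≤ n →
      ∑ k ∈ Finset.Icc 1 m, a k / k ≤ C * ((m : ℝ) / n) ^ (ρ / 2) * a n := by
  obtain ⟨C, hC, h⟩ := exists_le_mul_div_rpow_mul hL hρ ha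
  refine ⟨C / (ρ / 2), by positivity, fun m n hn hmn => ?_⟩
  have hn0 : (0 : ℝ) < n := by exact_mod_cast hn
  have han := (ha n hn).1
  calc ∑ k ∈ Finset.Icc 1 m, a k / k
      ≤ ∑ k ∈ Finset.Icc 1 m, C * a n / (n : ℝ) ^ (ρ / 2) * (k : ℝ) ^ (ρ / 2 - 1) := by
        refine Finset.sum_le_sum fun k hk => ?_
        obtain ⟨hk1, hkm⟩ := Finset.mem_Icc.1 hk
        have hk0 : (0 : ℝ) < k := by exact_mod_cast hk1
        rw [div_le_iff₀ hk0]
        refine (h k n hk1 (hkm.trans hmn)).trans (le_of_eq ?_)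
        rw [Real.div_rpow hk0.le hn0.le, Real.rpow_sub_one hk0.ne']
        field_simp
    _ ≤ C * a n / (n : ℝ) ^ (ρ / 2) * ((m : ℝ) ^ (ρ / 2) / (ρ / 2)) := by
        rw [← Finset.mul_sum]
        gcongr
        exact sum_Icc_rpow_sub_one_le (half_pos hρ) (by linarith) m
    _ = _ := by
        rw [Real.div_rpow (by positivity) hn0.le]
        ring

/-- The comparison of `a 1` with `a n` already forces growth at least like `n ^ (ρ / 2)`. -/
theorem tendsto_atTop_of_slowlyVarying {L : ℝ → ℝ} (hL : SlowlyVarying L) {ρ : ℝ} (hρ : 0 < ρ)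
    {a : ℕ → ℝ} (ha : ∀ n : ℕ, 1 ≤ n → 0 < a n ∧ a n = (n : ℝ) ^ ρ * L n) :
    Tendsto a atTop atTop := by
  obtain ⟨C, hC, h⟩ := exists_le_mul_div_rpow_mul hL hρ ha
  have h1 : Tendsto (fun n : ℕ => a 1 / C * (n : ℝ) ^ (ρ / 2)) atTop atTop :=
    ((tendsto_rpow_atTop (half_pos hρ)).comp tendsto_natCast_atTop_atTop).const_mul_atTop
      (div_pos (ha 1 le_rfl).1 hC)
  refine tendsto_atTop_mono' _ ?_ h1
  filter_upwards [eventually_ge_atTop 1] with n hn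
  have h2 := h 1 n le_rfl hn
  have hn0 : (0 : ℝ) < n := by exact_mod_cast hn
  rw [Nat.cast_one, Real.div_rpow zero_le_one hn0.le, Real.one_rpow] at h2
  have h3 : 0 < (n : ℝ) ^ (ρ / 2) := Real.rpow_pos_of_pos hn0 _
  calc a 1 / C * (n : ℝ) ^ (ρ / 2)
      ≤ (C * (1 / (n : ℝ) ^ (ρ / 2)) * a n) / C * (n : ℝ) ^ (ρ / 2) := by gcongr
    _ = a n := by field_simp

/-! ### Càdlàg paths: boundedness, countably many jumps, measurability. -/

theorem IsCadlagPath.of_continuous {T : Type*} [TopologicalSpace T] [Preorder T] {x : T → ℝ}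
    (hx : Continuous x) : IsCadlagPath x := fun t =>
  ⟨hx.continuousWithinAt, x t, hx.continuousAt.mono_left nhdsWithin_le_nhds⟩

theorem IsCadlagPath.exists_abs_le {T : Type*} [TopologicalSpace T] [LinearOrder T]
    [CompactSpace T] {x : T → ℝ} (hx : IsCadlagPath x) : ∃ B : ℝ, ∀ t, |x t| ≤ B := by
  have hloc : ∀ t : T, ∃ B : ℝ, ∀ᶠ s in 𝓝 t, |x s| ≤ B := by
    intro t
    obtain ⟨hr, l, hl⟩ := hx t
    refine ⟨max (|l| + 1) (|x t| + 1), ?_⟩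
    rw [← nhdsLT_sup_nhdsGE, eventually_sup]
    constructor
    · filter_upwards [hl.abs.eventually (ge_mem_nhds (lt_add_one |l|))] with s hs
      exact hs.trans (le_max_left _ _)
    · filter_upwards [hr.tendsto.abs.eventually (ge_mem_nhds (lt_add_one |x t|))] with s hs
      exact hs.trans (le_max_right _ _)
  choose B hB using hloc
  obtain ⟨F, -, hF⟩ := isCompact_univ.elim_nhds_subcover _ fun t _ => hB t
  obtain ⟨M, hM⟩ := (F.image B).bddAbove
  refine ⟨M, fun t => ?_⟩
  obtain ⟨s, hs, hst⟩ := Set.mem_iUnion₂.1 (hF (Set.mem_univ t))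
  exact le_trans hst (hM (Finset.mem_coe.2 (Finset.mem_image_of_mem _ hs)))

/-- Just to the left of `t` the path is within `η/2` of its left limit, so no jump there exceeds
`η`. Hence the jumps larger than `η` are isolated from the left, and such a set is countable. Where
the left neighbourhood is trivial, right-continuity is continuity. -/
theorem IsCadlagPath.countable_not_continuousAt {T : Type*} [TopologicalSpace T] [LinearOrder T]
    [OrderTopology T] [SecondCountableTopology T] {x : T → ℝ} (hx : IsCadlagPath x) :
    {t | ¬ ContinuousAt x t}.Countable := by
  choose hr l hl using hx
  let A : ℕ → Set T := fun j => {t | (𝓝[<] t).NeBot ∧ 1 / ((j : ℝ) + 1) < |x t - l t|}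
  have hA : ∀ j, (A j).Countable := by
    intro j
    have hη : (0 : ℝ) < 1 / ((j : ℝ) + 1) := by positivity
    set η := 1 / ((j : ℝ) + 1)
    have hsub : A j ⊆ {t ∈ A j | 𝓝[A j ∩ Set.Iio t] t = ⊥} := ?_
    · exact countable_setOfPred_isolated_left_within.mono hsub
    intro t ht
    refine ⟨ht, ?_⟩
    have h1 : ∀ᶠ s in 𝓝[<] t, |x s - l t| < η / 2 := by
      have := (hl t).eventually (Metric.ball_mem_nhds (l t) (half_pos hη))
      simpa [Real.dist_eq] using this
    have h2 : ∀ᶠ s in 𝓝[<] t, s ∉ A j := by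
      filter_upwards [h1, eventually_eventually_nhdsWithin.2 h1, self_mem_nhdsWithin]
        with s hs1 hs2 hst hsA
      have := hsA.1
      have hs3 : ∀ᶠ z in 𝓝[<] s, |x z - l t| ≤ η / 2 :=
        (hs2.filter_mono (nhdsWithin_mono _ (Set.Iio_subset_Iio (le_of_lt hst)))).mono
          fun z hz => hz.le
      have hs4 : |l s - l t| ≤ η / 2 := le_of_tendsto ((hl s).sub_const (l t)).abs hs3
      have hs5 := abs_sub_le (x s) (l t) (l s)
      rw [abs_sub_comm (l t)] at hs5
      linarith [hsA.2]
    rw [← empty_mem_iff_bot, Set.inter_comm, nhdsWithin_inter', mem_inf_principal]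
    filter_upwards [h2] with s hs hs'
    exact hs hs'
  refine (Set.countable_iUnion hA).mono fun t ht => ?_
  rcases eq_or_neBot (𝓝[<] t) with hbot | hne
  · refine absurd ?_ ht
    rw [ContinuousAt, ← nhdsLT_sup_nhdsGE, hbot, bot_sup_eq]
    exact hr t
  · have hne' : 0 < |x t - l t| := by
      rw [abs_pos, sub_ne_zero]
      intro heq
      refine ht ?_
      rw [ContinuousAt, ← nhdsLT_sup_nhdsGE, tendsto_sup]
      exact ⟨heq ▸ hl t, hr t⟩
    obtain ⟨j, hj⟩ := exists_nat_one_div_lt hne'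
    exact Set.mem_iUnion.2 ⟨j, hne, hj⟩

/-- By right-continuity the path is the limit of its values at grid points to the right of `t`,
projected back to `[0,1]`. -/
theorem IsCadlagPath.measurable {x : I → ℝ} (hx : IsCadlagPath x) : Measurable x := by
  let r : ℕ → I → I := fun n t =>
    Set.projIcc 0 1 zero_le_one (((⌊((n : ℝ) + 1) * t⌋₊ : ℝ) + 1) / ((n : ℝ) + 1))
  have hle : ∀ (n : ℕ) (t : I), (t : ℝ) ≤ ((⌊((n : ℝ) + 1) * t⌋₊ : ℝ) + 1) / ((n : ℝ) + 1) := by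
    intro n t
    have hn : (0 : ℝ) < (n : ℝ) + 1 := by positivity
    rw [le_div_iff₀ hn, mul_comm]
    exact (Nat.lt_floor_add_one _).le
  refine measurable_of_tendsto_metrizable (f := fun n t => x (r n t)) (fun n => ?_) ?_
  · exact (measurable_from_nat (f := fun k : ℕ => x (Set.projIcc 0 1 zero_le_one
      (((k : ℝ) + 1) / ((n : ℝ) + 1))))).comp
        (Nat.measurable_floor.comp (measurable_subtype_coe.const_mul _))
  · rw [tendsto_pi_nhds]
    intro t
    refine (hx t).1.tendsto.comp (tendsto_nhdsWithin_iff.2 ⟨?_, Eventually.of_forall fun n => ?_⟩)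
    · have h1 : Tendsto (fun n : ℕ => ((⌊((n : ℝ) + 1) * t⌋₊ : ℝ) + 1) / ((n : ℝ) + 1)) atTop
          (𝓝 (t : ℝ)) := by
        have h2 : Tendsto (fun n : ℕ => (t : ℝ) + 1 / ((n : ℝ) + 1)) atTop (𝓝 (t : ℝ)) := by
          simpa using tendsto_one_div_add_atTop_nhds_zero_nat.const_add (t : ℝ)
        refine tendsto_of_tendsto_of_tendsto_of_le_of_le tendsto_const_nhds h2 (fun n => hle n t)
          fun n => ?_
        have h3 : (⌊((n : ℝ) + 1) * t⌋₊ : ℝ) ≤ ((n : ℝ) + 1) * t :=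
          Nat.floor_le (mul_nonneg (by positivity) t.2.1)
        have hn : (0 : ℝ) < (n : ℝ) + 1 := by positivity
        simp only []
        rw [div_le_iff₀ hn]
        field_simp
        linarith
      have h2 := (continuous_projIcc (h := zero_le_one (α := ℝ))).continuousAt.tendsto.comp h1
      rwa [Set.projIcc_val] at h2
    · have := Set.monotone_projIcc (zero_le_one (α := ℝ)) (hle n t)
      rwa [Set.projIcc_val] at this

/-! ### Continuity of weighted integrals in the `J₁` topology; step paths. -/

namespace SkorokhodSpace

/-- The extension of a path to the real line by its values at the endpoints. -/
noncomputable def extend (y : SkorokhodSpace) (s : ℝ) : ℝ := y (Set.projIcc 0 1 zero_le_one s)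

theorem extend_coe (y : SkorokhodSpace) (t : I) : y.extend t = y t := by
  rw [extend, Set.projIcc_val]

theorem measurable_extend (y : SkorokhodSpace) : Measurable y.extend :=
  y.isCadlag.measurable.comp continuous_projIcc.measurable

theorem exists_abs_extend_le (y : SkorokhodSpace) : ∃ B : ℝ, ∀ s, |y.extend s| ≤ B := by
  obtain ⟨B, hB⟩ := y.isCadlag.exists_abs_le
  exact ⟨B, fun s => hB _⟩

/-- The identity is an admissible time change, so uniform closeness implies `J₁` closeness. -/
theorem edist_le_of_forall {x y : SkorokhodSpace} {r : ℝ≥0∞}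
    (h : ∀ t, edist (x t) (y t) ≤ r) : edist x y ≤ r := by
  rw [edist_def]
  refine (iInf_le _ (OrderIso.refl I)).trans ?_
  simp only [timeChangeCost, OrderIso.refl_apply, edist_self]
  exact sup_le (by simp) (iSup_le h)

theorem eventually_exists_timeChange (y : SkorokhodSpace) {δ : ℝ≥0∞} (hδ : 0 < δ) :
    ∀ᶠ z in 𝓝 y, ∃ lam : I ≃o I,
      ∀ t, edist (lam t) t < δ ∧ edist (z t) (y (lam t)) < δ := by
  filter_upwards [Metric.eball_mem_nhds y hδ] with z hz
  rw [Metric.mem_eball, edist_def, iInf_lt_iff] at hz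
  obtain ⟨lam, hlam⟩ := hz
  exact ⟨lam, fun t => ⟨((le_iSup (fun t : I => edist (lam t) t) t).trans le_sup_left).trans_lt hlam,
    ((le_iSup (fun t : I => edist (z t) (y (lam t))) t).trans le_sup_right).trans_lt hlam⟩⟩

/-- `z t` is close to `y (lam t)` with `lam t` close to `t`; continuity of `y` at `t` absorbs the
time change. -/
theorem tendsto_apply {y : SkorokhodSpace} {t : I} (hy : ContinuousAt y t) :
    Tendsto (fun z : SkorokhodSpace => z t) (𝓝 y) (𝓝 (y t)) := by
  rw [EMetric.tendsto_nhds]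
  intro ε hε
  have hε2 : 0 < ε / 2 := ENNReal.half_pos hε.ne'
  obtain ⟨δ, hδ, hyδ⟩ := EMetric.tendsto_nhds_nhds.1 hy (ε / 2) hε2
  filter_upwards [eventually_exists_timeChange y (lt_min hδ hε2)] with z hz
  obtain ⟨lam, hlam⟩ := hz
  obtain ⟨h1, h2⟩ := hlam t
  calc edist (z t) (y t) ≤ edist (z t) (y (lam t)) + edist (y (lam t)) (y t) := edist_triangle _ _ _
    _ < ε / 2 + ε / 2 := ENNReal.add_lt_add (h2.trans_le (min_le_right _ _))
        (hyδ (h1.trans_le (min_le_left _ _)))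
    _ = ε := ENNReal.add_halves ε

theorem eventually_abs_extend_le (y : SkorokhodSpace) :
    ∃ B : ℝ, ∀ᶠ z in 𝓝 y, ∀ s, |z.extend s| ≤ B := by
  obtain ⟨B, hB⟩ := y.isCadlag.exists_abs_le
  refine ⟨B + 1, ?_⟩
  filter_upwards [eventually_exists_timeChange y one_pos] with z hz s
  obtain ⟨lam, hlam⟩ := hz
  have h1 := (hlam (Set.projIcc 0 1 zero_le_one s)).2
  rw [edist_dist, ← ENNReal.ofReal_one, ENNReal.ofReal_lt_ofReal_iff one_pos, Real.dist_eq] at h1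
  have h2 := abs_sub_abs_le_abs_sub (z (Set.projIcc 0 1 zero_le_one s))
    (y (lam (Set.projIcc 0 1 zero_le_one s)))
  have h3 := hB (lam (Set.projIcc 0 1 zero_le_one s))
  simp only [extend]
  linarith

theorem ae_tendsto_extend (y : SkorokhodSpace) : ∀ᵐ s : ℝ, s ∈ Set.uIoc (0 : ℝ) 1 →
    Tendsto (fun z : SkorokhodSpace => z.extend s) (𝓝 y) (𝓝 (y.extend s)) := by
  have hc := (y.isCadlag.countable_not_continuousAt.image (Subtype.val : I → ℝ)).ae_notMem volume
  filter_upwards [hc] with s hs hs'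
  rw [Set.uIoc_of_le zero_le_one] at hs'
  have hsI : s ∈ I := ⟨hs'.1.le, hs'.2⟩
  simp only [extend, Set.projIcc_of_mem zero_le_one hsI]
  refine tendsto_apply ?_
  by_contra hcon
  exact hs ⟨⟨s, hsI⟩, hcon, rfl⟩

theorem intervalIntegrable_extend_mul (y : SkorokhodSpace) {K : ℝ → ℝ} {a b : ℝ}
    (hK : IntervalIntegrable K volume a b) :
    IntervalIntegrable (fun s => y.extend s * K s) volume a b := by
  obtain ⟨B, hB⟩ := y.exists_abs_extend_le
  rw [intervalIntegrable_iff] at hK ⊢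
  exact hK.bdd_mul y.measurable_extend.aestronglyMeasurable (ae_of_all _ hB)

/-- Convergence in the `J₁` topology implies weighted `L¹` convergence. -/
theorem tendsto_integral_abs_sub (y : SkorokhodSpace) {K : ℝ → ℝ}
    (hK : IntervalIntegrable K volume 0 1) :
    Tendsto (fun z : SkorokhodSpace => ∫ s in (0 : ℝ)..1, |z.extend s * K s - y.extend s * K s|)
      (𝓝 y) (𝓝 0) := by
  obtain ⟨B, hB⟩ := y.eventually_abs_extend_le
  have hBy := hB.self_of_nhds
  have h := intervalIntegral.tendsto_integral_filter_of_dominated_convergence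
    (μ := volume) (a := 0) (b := 1) (l := 𝓝 y) (f := fun _ => (0 : ℝ))
    (F := fun (z : SkorokhodSpace) s => |z.extend s * K s - y.extend s * K s|)
    (fun s => (B + B) * |K s|) ?_ ?_ (hK.abs.const_mul _) ?_
  · simpa using h
  · refine Eventually.of_forall fun z => ?_
    have := ((z.intervalIntegrable_extend_mul hK).sub (y.intervalIntegrable_extend_mul hK)).abs
    exact (intervalIntegrable_iff.1 this).aestronglyMeasurable
  · filter_upwards [hB] with z hz
    refine ae_of_all _ fun s _ => ?_
    rw [Real.norm_eq_abs, abs_abs, ← sub_mul, abs_mul]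
    gcongr
    exact (abs_sub _ _).trans (add_le_add (hz s) (hBy s))
  · filter_upwards [y.ae_tendsto_extend] with s hs hs'
    simpa using (((hs hs').mul_const (K s)).sub_const (y.extend s * K s)).abs

theorem continuous_integral_abs_mul {K : ℝ → ℝ} (hK : IntervalIntegrable K volume 0 1) :
    Continuous fun y : SkorokhodSpace => ∫ s in (0 : ℝ)..1, |y.extend s * K s| := by
  refine continuous_iff_continuousAt.2 fun y => ?_
  rw [ContinuousAt, tendsto_iff_dist_tendsto_zero]
  refine squeeze_zero (fun _ => dist_nonneg) (fun z => ?_) (y.tendsto_integral_abs_sub hK)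
  have hz := z.intervalIntegrable_extend_mul hK
  have hy := y.intervalIntegrable_extend_mul hK
  rw [Real.dist_eq, ← intervalIntegral.integral_sub hz.abs hy.abs]
  refine (intervalIntegral.abs_integral_le_integral_abs zero_le_one).trans ?_
  exact intervalIntegral.integral_mono_on zero_le_one (hz.abs.sub hy.abs).abs (hz.sub hy).abs
    fun s _ => abs_abs_sub_abs_le_abs_sub _ _

/-- The path `t ↦ ∫₀ᵗ g` of an integrable function. -/
noncomputable def primitive (g : ℝ → ℝ) (hg : IntervalIntegrable g volume 0 1) :
    SkorokhodSpace where
  toFun t := ∫ s in (0 : ℝ)..t, g s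
  isCadlag := by
    refine IsCadlagPath.of_continuous ?_
    have := intervalIntegral.continuousOn_primitive_interval' hg Set.left_mem_uIcc
    rw [Set.uIcc_of_le zero_le_one] at this
    exact continuousOn_iff_continuous_domRestrict.1 this

theorem primitive_apply {g : ℝ → ℝ} (hg : IntervalIntegrable g volume 0 1) (t : I) :
    primitive g hg t = ∫ s in (0 : ℝ)..t, g s := rfl

theorem edist_primitive_le {g h : ℝ → ℝ} (hg : IntervalIntegrable g volume 0 1)
    (hh : IntervalIntegrable h volume 0 1) :
    edist (primitive g hg) (primitive h hh) ≤
      ENNReal.ofReal (∫ s in (0 : ℝ)..1, |g s - h s|) := by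
  refine edist_le_of_forall fun t => ?_
  have hsub : Set.uIcc (0 : ℝ) t ⊆ Set.uIcc 0 1 := by
    rw [Set.uIcc_of_le t.2.1, Set.uIcc_of_le zero_le_one]
    exact Set.Icc_subset_Icc le_rfl t.2.2
  rw [edist_dist, Real.dist_eq, primitive_apply, primitive_apply,
    ← intervalIntegral.integral_sub (hg.mono_set hsub) (hh.mono_set hsub)]
  refine ENNReal.ofReal_le_ofReal
    ((intervalIntegral.abs_integral_le_integral_abs t.2.1).trans ?_)
  exact intervalIntegral.integral_mono_interval le_rfl t.2.1 t.2.2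
    (ae_of_all _ fun s => abs_nonneg _) (hg.sub hh).abs

/-- The path `t ↦ ∫₀ᵗ y(s) K(s) ds`. -/
noncomputable def weightedPrimitive (K : ℝ → ℝ) (hK : IntervalIntegrable K volume 0 1)
    (y : SkorokhodSpace) : SkorokhodSpace :=
  primitive (fun s => y.extend s * K s) (y.intervalIntegrable_extend_mul hK)

theorem continuous_weightedPrimitive {K : ℝ → ℝ} (hK : IntervalIntegrable K volume 0 1) :
    Continuous (weightedPrimitive K hK) := by
  refine continuous_iff_continuousAt.2 fun y => ?_
  rw [ContinuousAt, tendsto_iff_edist_tendsto_0]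
  have h := (ENNReal.continuous_ofReal.tendsto 0).comp (y.tendsto_integral_abs_sub hK)
  rw [ENNReal.ofReal_zero] at h
  exact tendsto_of_tendsto_of_tendsto_of_le_of_le tendsto_const_nhds h (fun _ => zero_le)
    fun z => edist_primitive_le _ _

/-- The step path `t ↦ v ⌊n t⌋`. -/
noncomputable def step (n : ℕ) (v : ℕ → ℝ) : SkorokhodSpace where
  toFun t := v ⌊(n : ℝ) * (t : ℝ)⌋₊
  isCadlag := by
    have hcont : Continuous fun s : I => (n : ℝ) * (s : ℝ) := by fun_prop
    have hmono : Monotone fun s : I => (n : ℝ) * (s : ℝ) := fun s t hst =>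
      mul_le_mul_of_nonneg_left hst (Nat.cast_nonneg n)
    have hnn : ∀ s : I, 0 ≤ (n : ℝ) * (s : ℝ) := fun s => mul_nonneg (Nat.cast_nonneg n) s.2.1
    intro t
    constructor
    · refine tendsto_const_nhds.congr' ?_
      filter_upwards [self_mem_nhdsWithin, nhdsWithin_le_nhds
        (hcont.continuousAt.eventually (gt_mem_nhds (Nat.lt_floor_add_one ((n : ℝ) * (t : ℝ)))))]
        with s hs1 hs2
      congr 1
      exact ((Nat.floor_eq_iff (hnn s)).2 ⟨(Nat.floor_le (hnn t)).trans (hmono hs1), hs2⟩).symm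
    · rcases (hnn t).eq_or_lt with h0 | hpos
      -- Here `t = 0` or `n = 0`, and `n s = 0` for every `s < t`.
      · refine ⟨v 0, tendsto_const_nhds.congr' ?_⟩
        filter_upwards [self_mem_nhdsWithin] with s hs
        have : (n : ℝ) * (s : ℝ) = 0 := le_antisymm ((hmono (le_of_lt hs)).trans h0.ge) (hnn s)
        rw [this, Nat.floor_zero]
      · have hc : 0 < ⌈(n : ℝ) * (t : ℝ)⌉₊ := Nat.ceil_pos.2 hpos
        have hlt : ((⌈(n : ℝ) * (t : ℝ)⌉₊ - 1 : ℕ) : ℝ) < (n : ℝ) * (t : ℝ) :=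
          Nat.lt_ceil.1 (Nat.sub_lt hc one_pos)
        have hn : (0 : ℝ) < n := pos_of_mul_pos_left hpos t.2.1
        -- Immediately to the left of `t`, `n s` lies in `[⌈n t⌉ - 1, ⌈n t⌉)`, also when `n t` is an
        -- integer.
        refine ⟨v (⌈(n : ℝ) * (t : ℝ)⌉₊ - 1), tendsto_const_nhds.congr' ?_⟩
        filter_upwards [self_mem_nhdsWithin, nhdsWithin_le_nhds
          (hcont.continuousAt.eventually (lt_mem_nhds hlt))] with s hs1 hs2
        congr 1
        refine ((Nat.floor_eq_iff (hnn s)).2 ⟨hs2.le, ?_⟩).symm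
        rw [Nat.cast_sub hc, Nat.cast_one, sub_add_cancel]
        exact (mul_lt_mul_of_pos_left hs1 hn).trans_le (Nat.le_ceil _)

theorem step_apply (n : ℕ) (v : ℕ → ℝ) (t : I) : step n v t = v ⌊(n : ℝ) * (t : ℝ)⌋₊ := rfl

theorem floor_mul_le (n : ℕ) (t : I) : ⌊(n : ℝ) * (t : ℝ)⌋₊ ≤ n :=
  Nat.floor_le_of_le (mul_le_of_le_one_right (Nat.cast_nonneg n) t.2.2)

/-- The step path depends only on `v 0, …, v n`, and does so in a 1-Lipschitz way, so Borel
measurability for `J₁` reduces to that of finitely many coordinates. -/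
theorem aemeasurable_step {Ω : Type*} [MeasurableSpace Ω] {P : Measure Ω} (n : ℕ)
    {v : Ω → ℕ → ℝ} (hv : ∀ k ≤ n, AEMeasurable (fun ω => v ω k) P) :
    AEMeasurable (fun ω => step n (v ω)) P := by
  let e : (Fin (n + 1) → ℝ) → SkorokhodSpace :=
    fun w => step n fun k => if h : k < n + 1 then w ⟨k, h⟩ else 0
  have he : Continuous e := by
    refine LipschitzWith.continuous (K := 1) fun w w' => ?_
    rw [ENNReal.coe_one, one_mul]
    refine edist_le_of_forall fun t => ?_
    have := Nat.lt_succ_of_le (floor_mul_le n t)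
    simp only [e, step_apply, Nat.succ_eq_add_one] at this ⊢
    simp only [this, dite_true]
    exact edist_le_pi_edist w w' _
  have hw : AEMeasurable (fun ω (k : Fin (n + 1)) => v ω k) P :=
    aemeasurable_pi_lambda _ fun k => hv k (Nat.lt_succ_iff.1 k.2)
  refine (he.measurable.comp_aemeasurable hw).congr (ae_of_all _ fun ω => ?_)
  ext t
  have := Nat.lt_succ_of_le (floor_mul_le n t)
  simp only [Nat.succ_eq_add_one] at this
  change (if h : ⌊(n : ℝ) * (t : ℝ)⌋₊ < n + 1 then _ else _) = _
  rw [dif_pos this]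
  rfl

theorem extend_step (n : ℕ) (v : ℕ → ℝ) {s : ℝ} (hs : s ∈ I) :
    (step n v).extend s = v ⌊(n : ℝ) * s⌋₊ := by
  rw [extend, Set.projIcc_of_mem zero_le_one hs, step_apply]

end SkorokhodSpace
-- The truncated kernel and the comparison of sums with integrals.
/-- The function `s ↦ 1 / s`, cut off at `ε`. -/
noncomputable def truncInv (ε s : ℝ) : ℝ := if ε < s then s⁻¹ else 0

theorem truncInv_nonneg {ε : ℝ} (hε : 0 < ε) (s : ℝ) : 0 ≤ truncInv ε s := by
  unfold truncInv
  split_ifs with h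
  · exact inv_nonneg.2 (hε.trans h).le
  · exact le_rfl

theorem truncInv_le_inv {ε s : ℝ} (hs : 0 ≤ s) : truncInv ε s ≤ s⁻¹ := by
  unfold truncInv
  split_ifs
  · exact le_rfl
  · exact inv_nonneg.2 hs

theorem measurable_truncInv (ε : ℝ) : Measurable (truncInv ε) :=
  Measurable.ite measurableSet_Ioi measurable_inv measurable_const

theorem abs_truncInv_le {ε : ℝ} (hε : 0 < ε) (s : ℝ) : |truncInv ε s| ≤ ε⁻¹ := by
  rw [abs_of_nonneg (truncInv_nonneg hε s), truncInv]
  split_ifs with h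
  · exact inv_anti₀ hε h.le
  · exact inv_nonneg.2 hε.le

theorem intervalIntegrable_truncInv {ε : ℝ} (hε : 0 < ε) (a b : ℝ) :
    IntervalIntegrable (truncInv ε) volume a b := by
  rw [intervalIntegrable_iff]
  exact Measure.integrableOn_of_bounded (M := ε⁻¹) (by simp)
    (measurable_truncInv ε).aestronglyMeasurable (ae_of_all _ (abs_truncInv_le hε))

theorem intervalIntegrable_indicator_truncInv {ε : ℝ} (hε : 0 < ε) (t a b : ℝ) :
    IntervalIntegrable ({s | s ≤ t}.indicator (truncInv ε)) volume a b := by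
  have h := intervalIntegrable_iff.1 (intervalIntegrable_truncInv hε a b)
  exact intervalIntegrable_iff.2 (h.indicator measurableSet_Iic)

/-- The integral of `truncInv ε` over the part below `t` of the `k`-th cell of length `1 / n`. -/
noncomputable def cellWeight (n : ℕ) (ε t : ℝ) (k : ℕ) : ℝ :=
  ∫ s in ((k : ℝ) / n)..((k + 1 : ℕ) : ℝ) / n, {s | s ≤ t}.indicator (truncInv ε) s

section cellWeight

variable {n : ℕ} {ε t : ℝ} {k : ℕ}

theorem cell_le (n k : ℕ) : (k : ℝ) / n ≤ ((k + 1 : ℕ) : ℝ) / n := by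
  gcongr
  exact Nat.le_succ k

theorem cellWeight_nonneg (hε : 0 < ε) : 0 ≤ cellWeight n ε t k :=
  intervalIntegral.integral_nonneg (cell_le n k) fun s _ =>
    Set.indicator_nonneg (fun s _ => truncInv_nonneg hε s) s

theorem cellWeight_le (hn : 1 ≤ n) (hε : 0 < ε) (hk : 1 ≤ k) : cellWeight n ε t k ≤ 1 / k := by
  have hn0 : (0 : ℝ) < n := by exact_mod_cast hn
  have hk0 : (0 : ℝ) < k := by exact_mod_cast hk
  calc cellWeight n ε t k ≤ ∫ _ in ((k : ℝ) / n)..((k + 1 : ℕ) : ℝ) / n, ((k : ℝ) / n)⁻¹ := by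
        refine intervalIntegral.integral_mono_on (cell_le n k)
          (intervalIntegrable_indicator_truncInv hε t _ _) intervalIntegrable_const fun s hs => ?_
        have hs0 : 0 < s := (div_pos hk0 hn0).trans_le hs.1
        refine (Set.indicator_le_self' (fun _ _ => truncInv_nonneg hε _) s).trans ?_
        exact (truncInv_le_inv hs0.le).trans (inv_anti₀ (div_pos hk0 hn0) hs.1)
    _ = 1 / k := by
        rw [intervalIntegral.integral_const, smul_eq_mul]
        push_cast
        field_simp
        ring

theorem cellWeight_eq_zero_of_lt (hn : 1 ≤ n) (ht : t ∈ I) (hk : ⌊(n : ℝ) * t⌋₊ < k) :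
    cellWeight n ε t k = 0 := by
  have hn0 : (0 : ℝ) < n := by exact_mod_cast hn
  have h1 : t < (k : ℝ) / n := by
    rw [lt_div_iff₀ hn0, mul_comm]
    exact (Nat.floor_lt (mul_nonneg hn0.le ht.1)).1 hk
  rw [cellWeight, ← intervalIntegral.integral_zero (a := (k : ℝ) / n)
    (b := ((k + 1 : ℕ) : ℝ) / n) (μ := volume)]
  refine intervalIntegral.integral_congr fun s hs => ?_
  rw [Set.uIcc_of_le (cell_le n k)] at hs
  exact Set.indicator_of_notMem (s := {s | s ≤ t}) (fun h : s ≤ t => (h1.trans_le hs.1).not_ge h)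
    (truncInv ε)

/-- The first cell lies entirely below the cut-off, so the index `0`, absent from the sum with
weights `1/k`, is absent from the integral too. -/
theorem cellWeight_zero (hε : 1 / (n : ℝ) ≤ ε) : cellWeight n ε t 0 = 0 := by
  rw [cellWeight, ← intervalIntegral.integral_zero (a := ((0 : ℕ) : ℝ) / n)
    (b := ((0 + 1 : ℕ) : ℝ) / n) (μ := volume)]
  refine intervalIntegral.integral_congr fun s hs => ?_
  rw [Set.uIcc_of_le (cell_le n 0)] at hs
  have hs2 : s ≤ ε := by
    refine hs.2.trans ?_
    simpa using hε
  simp [Set.indicator_apply, truncInv, hs2.not_gt]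

theorem le_cellWeight (hn : 1 ≤ n) (hε : 0 < ε) (ht : t ∈ I) (hk : ⌊(n : ℝ) * ε⌋₊ < k)
    (hkt : k < ⌊(n : ℝ) * t⌋₊) : 1 / ((k : ℝ) + 1) ≤ cellWeight n ε t k := by
  have hn0 : (0 : ℝ) < n := by exact_mod_cast hn
  have hk0 : (0 : ℝ) < k := by exact_mod_cast (Nat.zero_le _).trans_lt hk
  have h1 : ε < (k : ℝ) / n := by
    rw [lt_div_iff₀ hn0, mul_comm]
    exact (Nat.floor_lt (mul_nonneg hn0.le hε.le)).1 hk
  have h2 : ((k + 1 : ℕ) : ℝ) / n ≤ t := by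
    rw [div_le_iff₀ hn0, mul_comm]
    exact (Nat.le_floor_iff (mul_nonneg hn0.le ht.1)).1 hkt
  calc 1 / ((k : ℝ) + 1)
      = ∫ _ in ((k : ℝ) / n)..((k + 1 : ℕ) : ℝ) / n, (((k + 1 : ℕ) : ℝ) / n)⁻¹ := by
        rw [intervalIntegral.integral_const, smul_eq_mul]
        push_cast
        field_simp
        ring
    _ ≤ cellWeight n ε t k := by
        refine intervalIntegral.integral_mono_on (cell_le n k) intervalIntegrable_const
          (intervalIntegrable_indicator_truncInv hε t _ _) fun s hs => ?_
        have hs0 : 0 < s := (div_pos hk0 hn0).trans_le hs.1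
        rw [Set.indicator_of_mem (show s ∈ {s | s ≤ t} from hs.2.trans h2), truncInv,
          if_pos (h1.trans_le hs.1)]
        exact inv_anti₀ hs0 hs.2

theorem integral_extend_step_mul (hn : 1 ≤ n) (hε : 0 < ε) (ht : t ∈ I) (v : ℕ → ℝ) :
    ∫ s in (0 : ℝ)..t, (SkorokhodSpace.step n v).extend s * truncInv ε s =
      ∑ k ∈ Finset.range (n + 1), v k * cellWeight n ε t k := by
  have hn0 : (0 : ℝ) < n := by exact_mod_cast hn
  have hcell : ∀ k : ℕ, Set.EqOn
      (fun s => v k * {s | s ≤ t}.indicator (truncInv ε) s)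
      ({s | s ≤ t}.indicator fun s => v ⌊(n : ℝ) * s⌋₊ * truncInv ε s)
      (Set.Ioo ((k : ℝ) / n) (((k + 1 : ℕ) : ℝ) / n)) := by
    intro k s hs
    have h1 : (k : ℝ) < n * s := by rw [mul_comm]; exact (div_lt_iff₀ hn0).1 hs.1
    have h2 : (n : ℝ) * s < k + 1 := by
      rw [mul_comm]; exact_mod_cast (lt_div_iff₀ hn0).1 hs.2
    have h3 : ⌊(n : ℝ) * s⌋₊ = k :=
      (Nat.floor_eq_iff ((Nat.cast_nonneg k).trans h1.le)).2 ⟨h1.le, h2⟩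
    simp only [Set.indicator_apply, h3, mul_ite, mul_zero]
  -- The last cell starts at `1` and carries no mass for `t ≤ 1`; it lets the index run up to `n`,
  -- as in the sums.
  have ht' : t ∈ Set.Icc (0 : ℝ) (((n + 1 : ℕ) : ℝ) / n) :=
    ⟨ht.1, ht.2.trans ((one_le_div hn0).2 (by exact_mod_cast Nat.le_succ n))⟩
  calc ∫ s in (0 : ℝ)..t, (SkorokhodSpace.step n v).extend s * truncInv ε s
      = ∫ s in (0 : ℝ)..t, v ⌊(n : ℝ) * s⌋₊ * truncInv ε s := by
        refine intervalIntegral.integral_congr fun s hs => ?_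
        rw [Set.uIcc_of_le ht.1] at hs
        simp only [SkorokhodSpace.extend_step n v ⟨hs.1, hs.2.trans ht.2⟩]
    _ = ∫ s in (((0 : ℕ) : ℝ) / n)..((n + 1 : ℕ) : ℝ) / n,
          {s | s ≤ t}.indicator (fun s => v ⌊(n : ℝ) * s⌋₊ * truncInv ε s) s := by
        rw [Nat.cast_zero, zero_div, intervalIntegral.integral_indicator ht']
    _ = _ := by
        rw [← intervalIntegral.sum_integral_adjacent_intervals (a := fun k : ℕ => (k : ℝ) / n)]
        · refine Finset.sum_congr rfl fun k _ => ?_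
          rw [cellWeight, ← intervalIntegral.integral_const_mul]
          exact (intervalIntegral.integral_congr_Ioo_of_le (cell_le n k) (hcell k)).symm
        · intro k _
          refine ((intervalIntegrable_indicator_truncInv hε t _ _).const_mul (v k)).congr_uIoo ?_
          rw [Set.uIoo_of_le (cell_le n k)]
          exact hcell k

theorem integral_abs_extend_step_mul_le (hn : 1 ≤ n) (hε : 0 < ε) (hnε : 1 / (n : ℝ) ≤ ε)
    (v : ℕ → ℝ) :
    ∫ s in (0 : ℝ)..1, |(SkorokhodSpace.step n v).extend s * truncInv ε s| ≤
      ∑ k ∈ Finset.Icc 1 n, |v k| / k := by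
  have h : ∀ s, |(SkorokhodSpace.step n v).extend s * truncInv ε s| =
      (SkorokhodSpace.step n fun k => |v k|).extend s * truncInv ε s := fun s => by
    rw [abs_mul, abs_of_nonneg (truncInv_nonneg hε s)]
    rfl
  simp only [h]
  rw [integral_extend_step_mul hn hε ⟨zero_le_one, le_rfl⟩, Finset.range_eq_Ico,
    Finset.sum_eq_sum_Ico_succ_bot (Nat.succ_pos n), cellWeight_zero hnε, mul_zero, zero_add]
  refine Finset.sum_le_sum fun k hk => ?_
  rw [div_eq_mul_one_div]
  gcongr
  exact cellWeight_le hn hε (Finset.mem_Icc.1 hk).1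

/-- The three terms are the three sources of error: cells touched by the cut-off, the Riemann error
`1/k - 1/(k+1) ≤ 1/k²`, and the one cell in which `t` falls. -/
theorem abs_sub_cellWeight_le (hn : 1 ≤ n) (hε : 0 < ε) (ht : t ∈ I) (hk : 1 ≤ k) :
    |(if k ≤ ⌊(n : ℝ) * t⌋₊ then 1 / (k : ℝ) else 0) - cellWeight n ε t k| ≤
      (if k ≤ ⌊(n : ℝ) * ε⌋₊ then 1 / (k : ℝ) else 0) + 1 / (k : ℝ) * (1 / k) +
        if k = ⌊(n : ℝ) * t⌋₊ then 1 / (k : ℝ) else 0 := by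
  have hk0 : (0 : ℝ) < k := by exact_mod_cast hk
  have h0 := cellWeight_nonneg (n := n) (t := t) (k := k) hε
  have h1 := cellWeight_le (t := t) hn hε hk
  have h2 : 0 ≤ 1 / (k : ℝ) := by positivity
  have h3 : 0 ≤ 1 / (k : ℝ) * (1 / k) := by positivity
  rcases lt_trichotomy k ⌊(n : ℝ) * t⌋₊ with h | h | h
  · rw [if_pos h.le, if_neg h.ne, abs_of_nonneg (sub_nonneg.2 h1)]
    split_ifs with hke
    · linarith
    · have h4 := le_cellWeight hn hε ht (not_le.1 hke) h
      have h5 : 1 / (k : ℝ) - 1 / ((k : ℝ) + 1) ≤ 1 / (k : ℝ) * (1 / k) := by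
        rw [div_sub_div _ _ hk0.ne' (by positivity), div_mul_div_comm,
          div_le_div_iff₀ (by positivity) (by positivity)]
        nlinarith
      linarith
  · rw [if_pos h.le, if_pos h, abs_of_nonneg (sub_nonneg.2 h1)]
    split_ifs <;> linarith
  · rw [if_neg h.not_ge, if_neg h.ne', cellWeight_eq_zero_of_lt hn ht h, sub_zero, abs_zero]
    split_ifs <;> linarith

theorem abs_sum_sub_integral_extend_step_le (hn : 1 ≤ n) (hε : 0 < ε) (hε1 : ε ≤ 1)
    (hnε : 1 / (n : ℝ) ≤ ε) (ht : t ∈ I) (v : ℕ → ℝ) :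
    |∑ k ∈ Finset.Icc 1 ⌊(n : ℝ) * t⌋₊, v k / k -
        ∫ s in (0 : ℝ)..t, (SkorokhodSpace.step n v).extend s * truncInv ε s| ≤
      ∑ k ∈ Finset.Icc 1 ⌊(n : ℝ) * ε⌋₊, |v k| / k +
        ∑ k ∈ Finset.Icc 1 n, |v k| / k * (1 / k) + |v ⌊(n : ℝ) * t⌋₊| / ⌊(n : ℝ) * t⌋₊ := by
  have hfilter : ∀ (u : ℕ → ℝ) (x : ℝ), x ≤ 1 → ∑ k ∈ Finset.Icc 1 ⌊(n : ℝ) * x⌋₊, u k / k =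
      ∑ k ∈ Finset.Icc 1 n, u k * if k ≤ ⌊(n : ℝ) * x⌋₊ then 1 / (k : ℝ) else 0 := by
    intro u x hx
    have hle : ⌊(n : ℝ) * x⌋₊ ≤ n :=
      Nat.floor_le_of_le (mul_le_of_le_one_right (Nat.cast_nonneg n) hx)
    simp only [mul_ite, mul_zero, mul_one_div]
    rw [← Finset.sum_filter]
    refine Finset.sum_congr ?_ fun _ _ => rfl
    ext k
    simp only [Finset.mem_Icc, Finset.mem_filter]
    omega
  rw [hfilter _ _ ht.2, hfilter _ _ hε1, integral_extend_step_mul hn hε ht, Finset.range_eq_Ico,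
    Finset.sum_eq_sum_Ico_succ_bot (Nat.succ_pos n), cellWeight_zero hnε, mul_zero, zero_add]
  change |_ - ∑ k ∈ Finset.Icc 1 n, _| ≤ _
  rw [← Finset.sum_sub_distrib]
  calc |∑ k ∈ Finset.Icc 1 n, (v k * (if k ≤ ⌊(n : ℝ) * t⌋₊ then 1 / (k : ℝ) else 0) -
          v k * cellWeight n ε t k)|
      ≤ ∑ k ∈ Finset.Icc 1 n, |v k * (if k ≤ ⌊(n : ℝ) * t⌋₊ then 1 / (k : ℝ) else 0) -
          v k * cellWeight n ε t k| := Finset.abs_sum_le_sum_abs _ _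
    _ ≤ ∑ k ∈ Finset.Icc 1 n, (|v k| * (if k ≤ ⌊(n : ℝ) * ε⌋₊ then 1 / (k : ℝ) else 0) +
          |v k| / k * (1 / k) + if k = ⌊(n : ℝ) * t⌋₊ then |v k| / k else 0) := by
        refine Finset.sum_le_sum fun k hk => ?_
        rw [← mul_sub, abs_mul]
        refine (mul_le_mul_of_nonneg_left
          (abs_sub_cellWeight_le hn hε ht (Finset.mem_Icc.1 hk).1) (abs_nonneg _)).trans
          (le_of_eq ?_)
        split_ifs <;> ring
    _ ≤ _ := by
        rw [Finset.sum_add_distrib, Finset.sum_add_distrib]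
        gcongr
        rw [Finset.sum_ite_eq']
        split_ifs
        · exact le_rfl
        · positivity

end cellWeight
-- Approximation of convergence in distribution.
section ConvergingTogether

variable {E Ω Ω' : Type*} [MeasurableSpace Ω] [MeasurableSpace Ω'] [PseudoEMetricSpace E]
  [MeasurableSpace E] [BorelSpace E] {P : Measure Ω} [IsProbabilityMeasure P]
  {Q : Measure Ω'} [IsProbabilityMeasure Q]

/-- Converging together: if `V j n ⇒ Z j` as `n → ∞` for every `j`, `Z j → Y` in probability, and
`W n` is close to `V j n` in probability, then `W n ⇒ Y`. -/
theorem tendstoInDistribution_of_approx {W : ℕ → Ω → E} {Y : Ω' → E} {V : ℕ → ℕ → Ω → E}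
    {Z : ℕ → Ω' → E} (hW : ∀ n, AEMeasurable (W n) P)
    (hVZ : ∀ j, TendstoInDistribution (V j) atTop (Z j) (fun _ => P) Q)
    (hZY : TendstoInMeasure Q Z atTop Y)
    (hWV : ∀ δ : ℝ, 0 < δ → ∀ η : ℝ≥0∞, 0 < η →
      ∀ᶠ j in atTop, ∀ᶠ n in atTop, P {ω | ENNReal.ofReal δ ≤ edist (W n ω) (V j n ω)} ≤ η) :
    TendstoInDistribution W atTop Y (fun _ => P) Q := by
  have hY : AEMeasurable Y Q := hZY.aemeasurable fun j => (hVZ j).aemeasurable_limit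
  refine ⟨hW, hY, tendsto_of_forall_isClosed_limsup_le' fun F hF => ?_⟩
  simp only [ProbabilityMeasure.coe_mk]
  -- Passing from `W n` to `V j n` and from `Z j` to `Y` each thickens `F` by `δ` and costs `η/2`;
  -- one `j` serves both.
  have key : ∀ δ : ℝ, 0 < δ → limsup (fun n => P.map (W n) F) atTop ≤
      Q.map Y (Metric.cthickening (δ + δ) F) := by
    intro δ hδ
    refine ENNReal.le_of_forall_pos_le_add fun η hη _ => ?_
    have hη2 : (0 : ℝ≥0∞) < (η : ℝ≥0∞) / 2 := ENNReal.half_pos (by exact_mod_cast hη.ne')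
    have hδ' : 0 < ENNReal.ofReal δ := ENNReal.ofReal_pos.2 hδ
    obtain ⟨j, hj1, hj2⟩ := ((hWV δ hδ _ hη2).and
      ((hZY _ hδ').eventually (ge_mem_nhds hη2))).exists
    have h1 : ∀ᶠ n in atTop, P.map (W n) F ≤
        P.map (V j n) (Metric.cthickening δ F) + (η : ℝ≥0∞) / 2 := by
      filter_upwards [hj1] with n hn
      rw [Measure.map_apply_of_aemeasurable (hW n) hF.measurableSet,
        Measure.map_apply_of_aemeasurable ((hVZ j).forall_aemeasurable n)
          Metric.isClosed_cthickening.measurableSet]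
      refine le_trans ?_ (add_le_add le_rfl hn)
      refine (measure_mono fun ω hω => ?_).trans (measure_union_le _ _)
      rcases le_or_gt (ENNReal.ofReal δ) (edist (W n ω) (V j n ω)) with h | h
      · exact Or.inr h
      · refine Or.inl (Metric.mem_cthickening_of_edist_le _ _ δ F hω ?_)
        rw [edist_comm]
        exact h.le
    have h2 : Q.map (Z j) (Metric.cthickening δ F) ≤
        Q.map Y (Metric.cthickening (δ + δ) F) + (η : ℝ≥0∞) / 2 := by
      rw [Measure.map_apply_of_aemeasurable (hVZ j).aemeasurable_limit
          Metric.isClosed_cthickening.measurableSet,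
        Measure.map_apply_of_aemeasurable hY Metric.isClosed_cthickening.measurableSet]
      refine le_trans ?_ (add_le_add le_rfl hj2)
      refine (measure_mono fun ω hω => ?_).trans (measure_union_le _ _)
      rcases le_or_gt (ENNReal.ofReal δ) (edist (Z j ω) (Y ω)) with h | h
      · exact Or.inr h
      · refine Or.inl (Metric.cthickening_cthickening_subset hδ.le hδ.le F
          (Metric.mem_cthickening_of_edist_le _ _ δ _ hω ?_))
        rw [edist_comm]
        exact h.le
    have h3 := ProbabilityMeasure.limsup_measure_closed_le_of_tendsto (hVZ j).tendsto
      (Metric.isClosed_cthickening (δ := δ) (E := F))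
    simp only [ProbabilityMeasure.coe_mk] at h3
    calc limsup (fun n => P.map (W n) F) atTop
        ≤ limsup (fun n => P.map (V j n) (Metric.cthickening δ F) + (η : ℝ≥0∞) / 2) atTop :=
          limsup_le_limsup h1
      _ = limsup (fun n => P.map (V j n) (Metric.cthickening δ F)) atTop + (η : ℝ≥0∞) / 2 :=
          limsup_add_const _ _ _ (by isBoundedDefault) (by isBoundedDefault)
      _ ≤ Q.map Y (Metric.cthickening (δ + δ) F) + (η : ℝ≥0∞) / 2 + (η : ℝ≥0∞) / 2 :=
          add_le_add (h3.trans h2) le_rfl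
      _ = _ := by rw [add_assoc, ENNReal.add_halves]
  have : IsProbabilityMeasure (Q.map Y) := Measure.isProbabilityMeasure_map hY
  have hlim : Tendsto (fun δ : ℝ => Q.map Y (Metric.cthickening (δ + δ) F)) (𝓝[>] 0)
      (𝓝 (Q.map Y F)) := by
    refine (tendsto_measure_cthickening_of_isClosed ⟨1, one_pos, measure_ne_top _ _⟩ hF).comp ?_
    have : Tendsto (fun δ : ℝ => δ + δ) (𝓝 0) (𝓝 (0 + 0)) := by
      exact (continuous_id.add continuous_id).tendsto 0
    rw [add_zero] at this
    exact this.mono_left nhdsWithin_le_nhds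
  exact ge_of_tendsto hlim (eventually_mem_nhdsWithin.mono fun δ hδ => key δ hδ)

end ConvergingTogether

/-! ### Markov bounds and weighted averages. -/

section Probability

variable {Ω : Type*} [MeasurableSpace Ω] {P : Measure Ω}

theorem measure_le_ofReal_div {Z : Ω → ℝ} (hZ : AEMeasurable Z P) {M δ : ℝ} (hδ : 0 < δ)
    (hM : ∫⁻ ω, ENNReal.ofReal (Z ω) ∂P ≤ ENNReal.ofReal M) :
    P {ω | δ ≤ Z ω} ≤ ENNReal.ofReal (M / δ) := by
  calc P {ω | δ ≤ Z ω} ≤ P {ω | ENNReal.ofReal δ ≤ ENNReal.ofReal (Z ω)} :=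
        measure_mono fun ω hω => ENNReal.ofReal_le_ofReal hω
    _ ≤ (∫⁻ ω, ENNReal.ofReal (Z ω) ∂P) / ENNReal.ofReal δ :=
        meas_ge_le_lintegral_div hZ.ennreal_ofReal (ENNReal.ofReal_pos.2 hδ).ne'
          ENNReal.ofReal_ne_top
    _ ≤ _ := by
        rw [ENNReal.ofReal_div_of_pos hδ]
        gcongr

theorem eventually_measure_le_of_ae_tendsto_zero [IsFiniteMeasure P] {Z : ℕ → Ω → ℝ}
    (hZ : ∀ n, AEMeasurable (Z n) P) (hlim : ∀ᵐ ω ∂P, Tendsto (fun n => Z n ω) atTop (𝓝 0))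
    {δ : ℝ} (hδ : 0 < δ) {η : ℝ≥0∞} (hη : 0 < η) :
    ∀ᶠ n in atTop, P {ω | δ ≤ Z n ω} ≤ η := by
  have h := tendstoInMeasure_of_tendsto_ae (g := fun _ => (0 : ℝ))
    (fun n => (hZ n).aestronglyMeasurable) hlim (ENNReal.ofReal δ) (ENNReal.ofReal_pos.2 hδ)
  filter_upwards [h.eventually (ge_mem_nhds hη)] with n hn
  refine le_trans (measure_mono fun ω hω => ?_) hn
  rw [Set.mem_ofPred_eq, edist_dist, Real.dist_eq, sub_zero]
  exact ENNReal.ofReal_le_ofReal (le_trans hω (le_abs_self _))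

theorem tendsto_mul_sum_Icc_of_eventually_eq_zero {b c : ℕ → ℝ} (hb : Tendsto b atTop (𝓝 0))
    (hc : ∀ᶠ k in atTop, c k = 0) :
    Tendsto (fun n => b n * ∑ k ∈ Finset.Icc 1 n, c k) atTop (𝓝 0) := by
  obtain ⟨K, hK⟩ := eventually_atTop.1 hc
  have h := hb.mul_const (∑ k ∈ Finset.Icc 1 K, c k)
  rw [zero_mul] at h
  refine h.congr' ?_
  filter_upwards [eventually_ge_atTop K] with n hn
  congr 1
  refine Finset.sum_subset (Finset.Icc_subset_Icc_right hn) fun k hk hk' => hK k ?_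
  rw [Finset.mem_Icc] at hk hk'
  omega

/-- Weighted averages with weights tending to zero almost surely are negligible. -/
theorem eventually_measure_weighted_sum_le [IsFiniteMeasure P] {u g : ℕ → Ω → ℝ} {b : ℕ → ℝ}
    (hu : ∀ k, AEMeasurable (u k) P) (hg : ∀ k, AEMeasurable (g k) P) (hu0 : ∀ k ω, 0 ≤ u k ω)
    (hglim : ∀ᵐ ω ∂P, Tendsto (fun k => g k ω) atTop (𝓝 0))
    (hb0 : ∀ n, 1 ≤ n → 0 ≤ b n) (hb : Tendsto b atTop (𝓝 0)) {D : ℝ} (hD : 0 < D)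
    (hbound : ∀ n, 1 ≤ n →
      ∫⁻ ω, ENNReal.ofReal (b n * ∑ k ∈ Finset.Icc 1 n, u k ω) ∂P ≤ ENNReal.ofReal D)
    {δ η : ℝ} (hδ : 0 < δ) (hη : 0 < η) :
    ∀ᶠ n in atTop, P {ω | δ ≤ b n * ∑ k ∈ Finset.Icc 1 n, u k ω * g k ω} ≤
      ENNReal.ofReal η := by
  -- Chosen so that Markov's inequality at level `δ / (2θ)` gives exactly `η / 2`. The part of `g`
  -- below `θ` is then controlled by the mean bound; the excess over `θ` has almost surely finitely
  -- many nonzero terms and is killed by `b n → 0`.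
  set θ := (η / 2) * (δ / 2) / D with hθ
  have hθ0 : 0 < θ := by positivity
  have h1 := eventually_measure_le_of_ae_tendsto_zero (P := P) (δ := δ / 2)
    (η := ENNReal.ofReal (η / 2))
    (Z := fun n ω => b n * ∑ k ∈ Finset.Icc 1 n, u k ω * max (g k ω - θ) 0) (fun n => by fun_prop)
    ?_ (half_pos hδ) (ENNReal.ofReal_pos.2 (half_pos hη))
  · filter_upwards [h1, eventually_ge_atTop 1] with n hn1 hn
    have h2 : P {ω | δ / (2 * θ) ≤ b n * ∑ k ∈ Finset.Icc 1 n, u k ω} ≤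
        ENNReal.ofReal (η / 2) := by
      refine (measure_le_ofReal_div (by fun_prop) (by positivity) (hbound n hn)).trans
        (le_of_eq ?_)
      congr 1
      rw [hθ]
      field_simp
    rw [← add_halves η, ENNReal.ofReal_add (half_pos hη).le (half_pos hη).le]
    refine le_trans ((measure_mono fun ω hω => ?_).trans (measure_union_le _ _))
      (add_le_add h2 hn1)
    by_contra hcon
    simp only [Set.mem_union, Set.mem_ofPred_eq, not_or, not_le] at hcon hω
    have h3 : b n * ∑ k ∈ Finset.Icc 1 n, u k ω * g k ω ≤
        b n * (θ * (∑ k ∈ Finset.Icc 1 n, u k ω) +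
          ∑ k ∈ Finset.Icc 1 n, u k ω * max (g k ω - θ) 0) := by
      refine mul_le_mul_of_nonneg_left ?_ (hb0 n hn)
      rw [Finset.mul_sum, ← Finset.sum_add_distrib]
      refine Finset.sum_le_sum fun k _ => ?_
      nlinarith [hu0 k ω, le_max_left (g k ω - θ) 0]
    have h4 : θ * (b n * ∑ k ∈ Finset.Icc 1 n, u k ω) < δ / 2 := by
      have := mul_lt_mul_of_pos_left hcon.1 hθ0
      refine this.trans_le (le_of_eq ?_)
      field_simp
    linarith [hcon.2]
  · filter_upwards [hglim] with ω hω
    refine tendsto_mul_sum_Icc_of_eventually_eq_zero hb ?_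
    filter_upwards [hω.eventually (ge_mem_nhds hθ0)] with k hk
    rw [max_eq_right (by linarith), mul_zero]

theorem lintegral_mul_sum_le {u : ℕ → Ω → ℝ} (hu : ∀ k, AEMeasurable (u k) P)
    (hu0 : ∀ k ω, 0 ≤ u k ω) {b : ℝ} (hb : 0 ≤ b) {r : ℕ → ℝ} (hr0 : ∀ k, 1 ≤ k → 0 ≤ r k) {m : ℕ}
    (hur : ∀ k, 1 ≤ k → ∫⁻ ω, ENNReal.ofReal (u k ω) ∂P ≤ ENNReal.ofReal (r k)) :
    ∫⁻ ω, ENNReal.ofReal (b * ∑ k ∈ Finset.Icc 1 m, u k ω) ∂P ≤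
      ENNReal.ofReal (b * ∑ k ∈ Finset.Icc 1 m, r k) := by
  simp only [ENNReal.ofReal_mul hb]
  rw [lintegral_const_mul'' _ (by fun_prop)]
  gcongr
  rw [ENNReal.ofReal_sum_of_nonneg fun k hk => hr0 k (Finset.mem_Icc.1 hk).1]
  simp only [ENNReal.ofReal_sum_of_nonneg fun k _ => hu0 k _]
  rw [lintegral_finsetSum' _ fun k _ => (hu k).ennreal_ofReal]
  exact Finset.sum_le_sum fun k hk => hur k (Finset.mem_Icc.1 hk).1

end Probability

/-! ### Removing the cut-off: Fatou, dominated convergence and the deterministic error bound. -/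

namespace SkorokhodSpace

/-- The sequence of cut-off levels. -/
noncomputable def level (j : ℕ) : ℝ := 1 / ((j : ℝ) + 1)

theorem level_pos (j : ℕ) : 0 < level j := by unfold level; positivity

theorem level_le_one (j : ℕ) : level j ≤ 1 :=
  (div_le_one (by positivity)).2 (by linarith [(Nat.cast_nonneg j : (0 : ℝ) ≤ j)])

theorem tendsto_level : Tendsto level atTop (𝓝 0) := tendsto_one_div_add_atTop_nhds_zero_nat

theorem tendsto_truncInv_level {s : ℝ} (hs : 0 < s) :
    Tendsto (fun j => truncInv (level j) s) atTop (𝓝 s⁻¹) := by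
  refine tendsto_const_nhds.congr' ?_
  filter_upwards [tendsto_level.eventually (gt_mem_nhds hs)] with j hj
  rw [truncInv, if_pos hj]

/-- `∫₀¹ |y(s)| / s ds` with a cut-off. -/
noncomputable def truncNorm (j : ℕ) (y : SkorokhodSpace) : ℝ :=
  ∫ s in (0 : ℝ)..1, |y.extend s * truncInv (level j) s|

theorem continuous_truncNorm (j : ℕ) : Continuous (truncNorm j) :=
  continuous_integral_abs_mul (intervalIntegrable_truncInv (level_pos j) 0 1)

theorem truncNorm_nonneg (j : ℕ) (y : SkorokhodSpace) : 0 ≤ truncNorm j y :=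
  intervalIntegral.integral_nonneg zero_le_one fun _ _ => abs_nonneg _

theorem intervalIntegrable_extend_mul_truncInv (y : SkorokhodSpace) (j : ℕ) :
    IntervalIntegrable (fun s => y.extend s * truncInv (level j) s) volume 0 1 :=
  y.intervalIntegrable_extend_mul (intervalIntegrable_truncInv (level_pos j) 0 1)

theorem measurable_extend_mul_inv (y : SkorokhodSpace) : Measurable fun s => y.extend s * s⁻¹ :=
  y.measurable_extend.mul measurable_inv

theorem intervalIntegrable_extend_mul_inv_of_liminf_lt_top {y : SkorokhodSpace}
    (h : liminf (fun j => ENNReal.ofReal (truncNorm j y)) atTop < ∞) :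
    IntervalIntegrable (fun s => y.extend s * s⁻¹) volume 0 1 := by
  rw [intervalIntegrable_iff_integrableOn_Ioc_of_le zero_le_one]
  refine ⟨y.measurable_extend_mul_inv.aestronglyMeasurable, lt_of_le_of_lt ?_ h⟩
  have h1 : ∀ j, ENNReal.ofReal (truncNorm j y) =
      ∫⁻ s in Set.Ioc (0 : ℝ) 1, ‖y.extend s * truncInv (level j) s‖ₑ := by
    intro j
    have hi := y.intervalIntegrable_extend_mul_truncInv j
    rw [intervalIntegrable_iff_integrableOn_Ioc_of_le zero_le_one] at hi
    rw [truncNorm, intervalIntegral.integral_of_le zero_le_one]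
    exact ofReal_integral_norm_eq_lintegral_enorm hi
  simp only [h1]
  refine le_trans (le_of_eq ?_) (lintegral_liminf_le' fun j =>
    ((y.measurable_extend.mul (measurable_truncInv _)).enorm).aemeasurable)
  refine setLIntegral_congr_fun measurableSet_Ioc fun s hs => ?_
  exact (((tendsto_truncInv_level hs.1).const_mul (y.extend s)).enorm).liminf_eq.symm

/-- As `0 ≤ truncInv ≤ s⁻¹` on `[0,1]`, the absolute value splits. The truncation error is thereby
expressed through `truncNorm`, which is continuous and hence measurable on `D[0,1]`. -/
theorem integral_abs_sub_truncInv {y : SkorokhodSpace}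
    (hy : IntervalIntegrable (fun s => y.extend s * s⁻¹) volume 0 1) (j : ℕ) :
    ∫ s in (0 : ℝ)..1, |y.extend s * truncInv (level j) s - y.extend s * s⁻¹| =
      (∫ s in (0 : ℝ)..1, |y.extend s * s⁻¹|) - truncNorm j y := by
  rw [truncNorm, ← intervalIntegral.integral_sub hy.abs
    (y.intervalIntegrable_extend_mul_truncInv j).abs]
  refine intervalIntegral.integral_congr fun s hs => ?_
  rw [Set.uIcc_of_le zero_le_one] at hs
  have h1 := truncInv_le_inv (ε := level j) hs.1
  have h2 := truncInv_nonneg (level_pos j) s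
  simp only [← mul_sub, abs_mul]
  rw [abs_of_nonneg h2, abs_of_nonneg (inv_nonneg.2 hs.1), abs_of_nonpos (sub_nonpos.2 h1)]
  ring

theorem tendsto_integral_abs_sub_truncInv {y : SkorokhodSpace}
    (hy : IntervalIntegrable (fun s => y.extend s * s⁻¹) volume 0 1) :
    Tendsto (fun j => ∫ s in (0 : ℝ)..1, |y.extend s * truncInv (level j) s - y.extend s * s⁻¹|)
      atTop (𝓝 0) := by
  have h := intervalIntegral.tendsto_integral_filter_of_dominated_convergence
    (μ := volume) (a := 0) (b := 1) (l := atTop) (f := fun _ => (0 : ℝ))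
    (F := fun j s => |y.extend s * truncInv (level j) s - y.extend s * s⁻¹|)
    (fun s => |y.extend s * s⁻¹|) ?_ ?_ hy.abs ?_
  · simpa using h
  · refine Eventually.of_forall fun j => ?_
    exact (intervalIntegrable_iff.1
      ((y.intervalIntegrable_extend_mul_truncInv j).sub hy).abs).aestronglyMeasurable
  · refine Eventually.of_forall fun j => ae_of_all _ fun s hs => ?_
    rw [Set.uIoc_of_le zero_le_one] at hs
    have h1 := truncInv_le_inv (ε := level j) hs.1.le
    have h2 := truncInv_nonneg (level_pos j) s
    rw [Real.norm_eq_abs, abs_abs, ← mul_sub, abs_mul, abs_mul]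
    refine mul_le_mul_of_nonneg_left ?_ (abs_nonneg _)
    rw [abs_of_nonpos (sub_nonpos.2 h1), abs_of_nonneg (inv_nonneg.2 hs.1.le)]
    linarith
  · refine ae_of_all _ fun s hs => ?_
    rw [Set.uIoc_of_le zero_le_one] at hs
    simpa using (((tendsto_truncInv_level hs.1).const_mul (y.extend s)).sub_const
      (y.extend s * s⁻¹)).abs

theorem intervalIntegrable_const_mul_truncInv (c : ℝ) (j : ℕ) :
    IntervalIntegrable (fun s => c * truncInv (level j) s) volume 0 1 :=
  (intervalIntegrable_truncInv (level_pos j) 0 1).const_mul c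

/-- The path `t ↦ c ∫₀ᵗ y(s) / s ds` with a cut-off. -/
noncomputable def truncPrimitive (c : ℝ) (j : ℕ) : SkorokhodSpace → SkorokhodSpace :=
  weightedPrimitive _ (intervalIntegrable_const_mul_truncInv c j)

theorem truncPrimitive_apply (c : ℝ) (j : ℕ) (y : SkorokhodSpace) (t : I) :
    truncPrimitive c j y t = c * ∫ s in (0 : ℝ)..t, y.extend s * truncInv (level j) s := by
  rw [truncPrimitive, weightedPrimitive, primitive_apply, ← intervalIntegral.integral_const_mul]
  simp only [mul_left_comm]

theorem continuous_truncPrimitive (c : ℝ) (j : ℕ) : Continuous (truncPrimitive c j) :=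
  continuous_weightedPrimitive _

open Classical in
/-- The path `t ↦ c ∫₀ᵗ y(s) / s ds`, and the zero path if `y(s) / s` is not integrable. -/
noncomputable def singularPrimitive (c : ℝ) (y : SkorokhodSpace) : SkorokhodSpace :=
  if hy : IntervalIntegrable (fun s => y.extend s * s⁻¹) volume 0 1 then
    primitive _ (hy.const_mul c)
  else step 0 0

theorem singularPrimitive_apply (c : ℝ) {y : SkorokhodSpace}
    (hy : IntervalIntegrable (fun s => y.extend s * s⁻¹) volume 0 1) (t : I) :
    singularPrimitive c y t = c * ∫ s in (0 : ℝ)..t, y.extend s * s⁻¹ := by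
  rw [singularPrimitive, dif_pos hy, primitive_apply, intervalIntegral.integral_const_mul]

theorem edist_truncPrimitive_singularPrimitive_le (c : ℝ) (j : ℕ) {y : SkorokhodSpace}
    (hy : IntervalIntegrable (fun s => y.extend s * s⁻¹) volume 0 1) :
    edist (truncPrimitive c j y) (singularPrimitive c y) ≤ ENNReal.ofReal
      (|c| * ∫ s in (0 : ℝ)..1, |y.extend s * truncInv (level j) s - y.extend s * s⁻¹|) := by
  rw [singularPrimitive, dif_pos hy, truncPrimitive, weightedPrimitive,
    ← intervalIntegral.integral_const_mul]
  refine (edist_primitive_le _ _).trans (le_of_eq ?_)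
  congr 2
  ext s
  rw [← abs_mul]
  congr 1
  ring

/-- In probability, the cut-off in `t ↦ c ∫₀ᵗ Y(s) / s ds` is negligible. -/
theorem tendstoInMeasure_truncPrimitive {Ω : Type*} [MeasurableSpace Ω] {Q : Measure Ω}
    [IsFiniteMeasure Q] (c : ℝ) {Y : Ω → SkorokhodSpace} (hY : AEMeasurable Y Q)
    (hint : ∀ᵐ ω ∂Q, IntervalIntegrable (fun s => (Y ω).extend s * s⁻¹) volume 0 1) :
    TendstoInMeasure Q (fun j ω => truncPrimitive c j (Y ω)) atTop
      (fun ω => singularPrimitive c (Y ω)) := by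
  have hae : ∀ᵐ ω ∂Q, Tendsto (fun j => |c| * truncNorm j (Y ω)) atTop
      (𝓝 (|c| * ∫ s in (0 : ℝ)..1, |(Y ω).extend s * s⁻¹|)) := by
    filter_upwards [hint] with ω hω
    refine Tendsto.const_mul _ ?_
    have := (tendsto_integral_abs_sub_truncInv hω).const_sub
      (∫ s in (0 : ℝ)..1, |(Y ω).extend s * s⁻¹|)
    rw [sub_zero] at this
    refine this.congr fun j => ?_
    rw [integral_abs_sub_truncInv hω]
    ring
  -- Almost sure convergence is turned into convergence in measure for the real-valued `truncNorm`,
  -- which dominates the distance; no measurability of `singularPrimitive` has to be checked.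
  have h := tendstoInMeasure_of_tendsto_ae (fun j =>
    (((continuous_truncNorm j).measurable.comp_aemeasurable hY).const_mul
      |c|).aestronglyMeasurable) hae
  intro ε hε
  refine tendsto_of_tendsto_of_tendsto_of_le_of_le tendsto_const_nhds (h ε hε)
    (fun _ => zero_le) fun j => measure_mono_ae ?_
  filter_upwards [hint] with ω hω hle
  refine le_trans hle ((edist_truncPrimitive_singularPrimitive_le c j hω).trans ?_)
  rw [integral_abs_sub_truncInv hω, edist_comm, edist_dist, Real.dist_eq, mul_sub]
  exact ENNReal.ofReal_le_ofReal (le_abs_self _)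

/-- The distance of the step path of the sums to the integral of the step path of the summands. -/
theorem edist_step_sum_truncPrimitive_le {n : ℕ} (hn : 1 ≤ n) (j : ℕ)
    (hnj : 1 / (n : ℝ) ≤ level j) {b : ℝ} (hb : 0 ≤ b) (c : ℝ) (y r : ℕ → ℝ) :
    edist (step n fun i => b * ∑ k ∈ Finset.Icc 1 i, (c * (y k / k) + r k))
        (truncPrimitive c j (step n fun k => b * y k)) ≤
      ENNReal.ofReal (b * ∑ k ∈ Finset.Icc 1 n, (|r k| + |c| * (|y k| / k * (1 / k))) +
        |c| * (b * ∑ k ∈ Finset.Icc 1 ⌊(n : ℝ) * level j⌋₊, |y k| / k) +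
        |c| * (b * (1 + ∑ k ∈ Finset.Icc 1 n, max (|y k| / k - 1) 0))) := by
  refine edist_le_of_forall fun t => ?_
  rw [edist_dist, Real.dist_eq, step_apply, truncPrimitive_apply]
  refine ENNReal.ofReal_le_ofReal ?_
  set N := ⌊(n : ℝ) * (t : ℝ)⌋₊ with hN
  have hNn : N ≤ n := floor_mul_le n t
  have h1 := abs_sum_sub_integral_extend_step_le hn (level_pos j) (level_le_one j) hnj t.2
    fun k => b * y k
  rw [← hN] at h1
  set T := ∫ s in (0 : ℝ)..t, (step n fun k => b * y k).extend s * truncInv (level j) s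
  have h2 : b * ∑ k ∈ Finset.Icc 1 N, (c * (y k / k) + r k) - c * T =
      c * (∑ k ∈ Finset.Icc 1 N, b * y k / k - T) + b * ∑ k ∈ Finset.Icc 1 N, r k := by
    rw [Finset.sum_add_distrib, ← Finset.mul_sum]
    simp only [mul_div_assoc]
    rw [← Finset.mul_sum]
    ring
  have h3 : |∑ k ∈ Finset.Icc 1 N, r k| ≤ ∑ k ∈ Finset.Icc 1 n, |r k| :=
    (Finset.abs_sum_le_sum_abs _ _).trans (Finset.sum_le_sum_of_subset_of_nonneg
      (Finset.Icc_subset_Icc_right hNn) fun _ _ _ => abs_nonneg _)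
  -- The cell containing `t` must be bounded uniformly in `t`. Since `|y k| / k → 0` almost surely,
  -- this right-hand side stays bounded in `n`, and the factor `b` makes it vanish. For `N = 0` the
  -- quotient is zero by convention.
  have h4 : |y N| / N ≤ 1 + ∑ k ∈ Finset.Icc 1 n, max (|y k| / k - 1) 0 := by
    have hnn : ∀ k ∈ Finset.Icc 1 n, 0 ≤ max (|y k| / k - 1) 0 := fun _ _ => le_max_right _ _
    rcases Nat.eq_zero_or_pos N with h0 | hpos
    · rw [h0, Nat.cast_zero, div_zero]
      exact add_nonneg zero_le_one (Finset.sum_nonneg hnn)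
    · have := Finset.single_le_sum hnn (Finset.mem_Icc.2 ⟨hpos, hNn⟩)
      linarith [le_max_left (|y N| / N - 1) 0]
  simp only [abs_mul, abs_of_nonneg hb, mul_div_assoc, mul_assoc, ← Finset.mul_sum] at h1
  rw [h2, Finset.sum_add_distrib, ← Finset.mul_sum]
  refine (abs_add_le _ _).trans ?_
  rw [abs_mul, abs_mul, abs_of_nonneg hb]
  have h5 := mul_le_mul_of_nonneg_left h1 (abs_nonneg c)
  have h6 := mul_le_mul_of_nonneg_left h3 hb
  have h7 := mul_le_mul_of_nonneg_left (mul_le_mul_of_nonneg_left h4 hb) (abs_nonneg c)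
  simp only [mul_div_assoc, ← Finset.mul_sum] at h5 ⊢
  linarith

end SkorokhodSpace
-- Integrability of the limit and assembly of the proof.
open SkorokhodSpace in
/-- If `V n ⇒ Y` and the expectations of `∫₀¹ |V n (s)| / s ds`, cut off near zero, are bounded,
then `Y(s) / s` is almost surely integrable. -/
theorem ae_intervalIntegrable_extend_mul_inv {Ω Ω' : Type*} [MeasurableSpace Ω]
    [MeasurableSpace Ω'] {P : Measure Ω} [IsProbabilityMeasure P] {Q : Measure Ω'}
    [IsProbabilityMeasure Q] {V : ℕ → Ω → SkorokhodSpace} {Y : Ω' → SkorokhodSpace}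
    (hVY : TendstoInDistribution V atTop Y (fun _ => P) Q) {M : ℝ}
    (hM : ∀ j, ∀ᶠ n in atTop,
      ∫⁻ ω, ENNReal.ofReal (truncNorm j (V n ω)) ∂P ≤ ENNReal.ofReal M) :
    ∀ᵐ ω ∂Q, IntervalIntegrable (fun s => (Y ω).extend s * s⁻¹) volume 0 1 := by
  have hY := hVY.aemeasurable_limit
  have hmeas : ∀ j, Measurable fun y : SkorokhodSpace => ENNReal.ofReal (truncNorm j y) :=
    fun j => (continuous_truncNorm j).measurable.ennreal_ofReal
  have h1 : ∀ j, ∫⁻ ω, ENNReal.ofReal (truncNorm j (Y ω)) ∂Q ≤ ENNReal.ofReal M := by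
    intro j
    -- Weak convergence makes means of nonnegative continuous functionals lower semicontinuous, for
    -- a fixed cut-off; a second use of Fatou, below, sends the cut-off to zero.
    have h2 := lintegral_le_liminf_lintegral_of_forall_isOpen_measure_le_liminf_measure
      (μ := Q.map Y) (μs := fun n => P.map (V n)) (continuous_truncNorm j)
      (truncNorm_nonneg j) fun G hG =>
        ProbabilityMeasure.le_liminf_measure_open_of_tendsto hVY.tendsto hG
    rw [lintegral_map' (hmeas j).aemeasurable hY] at h2
    simp only [lintegral_map' (hmeas j).aemeasurable (hVY.forall_aemeasurable _)] at h2
    exact h2.trans (liminf_le_of_frequently_le' (hM j).frequently)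
  have h3 : ∀ᵐ ω ∂Q, liminf (fun j => ENNReal.ofReal (truncNorm j (Y ω))) atTop < ∞ := by
    refine ae_lt_top' ((Measurable.liminf hmeas).comp_aemeasurable hY)
      (ne_of_lt (lt_of_le_of_lt ?_ (ENNReal.ofReal_lt_top (r := M))))
    exact (lintegral_liminf_le' fun j => (hmeas j).comp_aemeasurable hY).trans
      (liminf_le_of_frequently_le' (Frequently.of_forall h1))
  filter_upwards [h3] with ω hω
  exact intervalIntegrable_extend_mul_inv_of_liminf_lt_top hω

/-- The remainder of the linearization at the sample means, relative to the deviation, vanishes. -/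
theorem tendsto_linearization_remainder {f : ℝ → ℝ} {f' μ : ℝ} {J : Set ℝ}
    (hf : HasDerivWithinAt f f' J μ) {x : ℕ → ℝ} (hx : Tendsto x atTop (𝓝 μ))
    (hxJ : ∀ k, 1 ≤ k → x k ∈ J) :
    Tendsto (fun k => |f (x k) - f μ - f' * (x k - μ)| / |x k - μ|) atTop (𝓝 0) := by
  have h1 : Tendsto x atTop (𝓝[J] μ) :=
    tendsto_nhdsWithin_iff.2 ⟨hx, (eventually_ge_atTop 1).mono hxJ⟩
  have h2 := (hf.isLittleO.comp_tendsto h1).tendsto_div_nhds_zero.abs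
  rw [abs_zero] at h2
  refine h2.congr fun k => ?_
  simp only [Function.comp_apply, abs_div, smul_eq_mul, mul_comm f']

theorem tendstoInDistributionD_sum {Ω Ω' : Type*} [MeasurableSpace Ω] [MeasurableSpace Ω']
    (P : Measure Ω) [IsProbabilityMeasure P] (Q : Measure Ω') [IsProbabilityMeasure Q]
    {ρ : ℝ} (hρ : 0 < ρ) (hρ1 : ρ ≤ 1) (X : ℝ≥0 → Ω' → ℝ)
    (S : ℕ → Ω → ℝ) (hS : ∀ k, AEMeasurable (S k) P) (μ : ℝ)
    (L : ℝ → ℝ) (hL : SlowlyVarying L)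
    (a : ℕ → ℝ) (ha : ∀ n : ℕ, 1 ≤ n → 0 < a n ∧ a n = (n : ℝ) ^ ρ * L n)
    (hconv : TendstoInDistributionD
      (fun n t ω => (S ⌊(n : ℝ) * (t : ℝ)⌋₊ ω - (⌊(n : ℝ) * (t : ℝ)⌋₊ : ℝ) * μ) / a n) P
      (fun t ω => X (t : ℝ).toNNReal ω) Q)
    (hmean : (⨆ (n : ℕ) (_ : 1 ≤ n),
      (∫⁻ ω, ‖S n ω - (n : ℝ) * μ‖ₑ ∂P) / ENNReal.ofReal (a n)) < ∞)
    (hlln : ∀ᵐ ω ∂P, Tendsto (fun n : ℕ => S n ω / (n : ℝ)) atTop (𝓝 μ))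
    (J : Set ℝ) (hSJ : ∀ k : ℕ, 1 ≤ k → ∀ᵐ ω ∂P, S k ω / (k : ℝ) ∈ J)
    (f : ℝ → ℝ) (f' : ℝ) (hf : HasDerivWithinAt f f' J μ)
    (hfm : ∀ k : ℕ, 1 ≤ k → AEMeasurable (fun ω => f (S k ω / (k : ℝ))) P) :
    (∀ᵐ ω ∂Q, IntervalIntegrable (fun x : ℝ => X x.toNNReal ω / x) volume 0 1) ∧
    TendstoInDistributionD
      (fun n t ω => (1 / a n) *
        ∑ k ∈ Finset.Icc 1 ⌊(n : ℝ) * (t : ℝ)⌋₊, (f (S k ω / (k : ℝ)) - f μ)) P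
      (fun t ω => f' * ∫ x in (0 : ℝ)..(t : ℝ), X x.toNNReal ω / x) Q := by
  obtain ⟨X', Y, hX', hYX, hXY⟩ := hconv
  let y : ℕ → Ω → ℝ := fun k ω => S k ω - k * μ
  let u : ℕ → Ω → ℝ := fun k ω => |y k ω| / k
  let r : ℕ → Ω → ℝ := fun k ω => f (S k ω / k) - f μ - f' * (y k ω / k)
  -- Linearization remainder and Riemann error, both relative to the weight `u k`, so that one
  -- weighted-average estimate covers both.
  let g : ℕ → Ω → ℝ := fun k ω => |r k ω| / u k ω + |f'| * (1 / k)
  have hy : ∀ k, AEMeasurable (y k) P := fun k => (hS k).sub_const _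
  have hu : ∀ k, AEMeasurable (u k) P := fun k => (hy k).abs.div_const _
  have hu0 : ∀ k ω, 0 ≤ u k ω := fun k ω => by positivity
  have hyk : ∀ k : ℕ, 1 ≤ k → ∀ ω, y k ω / k = S k ω / k - μ := by
    intro k hk ω
    have hk0 : (k : ℝ) ≠ 0 := by exact_mod_cast (Nat.one_le_iff_ne_zero.1 hk)
    simp only [y]
    field_simp
  have huk : ∀ k : ℕ, 1 ≤ k → ∀ ω, u k ω = |S k ω / k - μ| := by
    intro k hk ω
    rw [← hyk k hk, abs_div, Nat.abs_cast]
  have hb0 : ∀ n, 1 ≤ n → 0 ≤ 1 / a n := fun n hn => one_div_nonneg.2 (ha n hn).1.le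
  have hb : Tendsto (fun n => 1 / a n) atTop (𝓝 0) :=
    (tendsto_const_nhds (x := (1 : ℝ))).div_atTop (tendsto_atTop_of_slowlyVarying hL hρ ha)
  -- Measurability of `f (S k / k)` is given only for `k ≥ 1`, hence the value `0` at the index `0`.
  have hg : ∀ k, AEMeasurable (if k = 0 then 0 else g k) P := by
    intro k
    split_ifs with hk
    · exact aemeasurable_const
    · have := hfm k (Nat.one_le_iff_ne_zero.2 hk)
      exact ((((this.sub_const _).sub (((hy k).div_const _).const_mul _)).abs).div
        (hu k)).add_const _
  have hulim : ∀ᵐ ω ∂P, Tendsto (fun k => u k ω) atTop (𝓝 0) := by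
    filter_upwards [hlln] with ω hω
    have h1 := (hω.sub_const μ).abs
    rw [sub_self, abs_zero] at h1
    refine h1.congr' ?_
    filter_upwards [eventually_ge_atTop 1] with k hk
    exact (huk k hk ω).symm
  have hglim : ∀ᵐ ω ∂P, Tendsto (fun k => (if k = 0 then 0 else g k) ω) atTop (𝓝 0) := by
    filter_upwards [hlln, ae_all_iff.2 fun k => eventually_imp_distrib_left.2 (hSJ k)]
      with ω hω hωJ
    have h1 := (tendsto_linearization_remainder hf hω hωJ).add
      ((tendsto_one_div_atTop_nhds_zero_nat (𝕜 := ℝ)).const_mul |f'|)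
    rw [mul_zero, add_zero] at h1
    refine h1.congr' ?_
    filter_upwards [eventually_ge_atTop 1] with k hk
    rw [if_neg (Nat.one_le_iff_ne_zero.1 hk)]
    simp only [g, r, huk k hk, hyk k hk]
  obtain ⟨D, hD, huD⟩ : ∃ D > 0, ∀ k : ℕ, 1 ≤ k →
      ∫⁻ ω, ENNReal.ofReal (u k ω) ∂P ≤ ENNReal.ofReal (D * (a k / k)) := by
    -- The supremum of the normalized means; the added `1` only makes the constant positive.
    refine ⟨(⨆ (n : ℕ) (_ : 1 ≤ n),
      (∫⁻ ω, ‖S n ω - (n : ℝ) * μ‖ₑ ∂P) / ENNReal.ofReal (a n)).toReal + 1, by positivity,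
      fun k hk => ?_⟩
    set M := ⨆ (n : ℕ) (_ : 1 ≤ n),
      (∫⁻ ω, ‖S n ω - (n : ℝ) * μ‖ₑ ∂P) / ENNReal.ofReal (a n)
    have hak := (ha k hk).1
    have hk0 : (0 : ℝ) < k := by exact_mod_cast hk
    have h1 : (∫⁻ ω, ‖y k ω‖ₑ ∂P) / ENNReal.ofReal (a k) ≤ M :=
      le_iSup₂ (f := fun (n : ℕ) (_ : 1 ≤ n) =>
        (∫⁻ ω, ‖S n ω - (n : ℝ) * μ‖ₑ ∂P) / ENNReal.ofReal (a n)) k hk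
    rw [ENNReal.div_le_iff (ENNReal.ofReal_pos.2 hak).ne' ENNReal.ofReal_ne_top,
      ← ENNReal.ofReal_toReal hmean.ne, ← ENNReal.ofReal_mul ENNReal.toReal_nonneg] at h1
    calc ∫⁻ ω, ENNReal.ofReal (u k ω) ∂P
        = ∫⁻ ω, ‖y k ω‖ₑ * ENNReal.ofReal ((k : ℝ)⁻¹) ∂P := by
          refine lintegral_congr fun ω => ?_
          rw [Real.enorm_eq_ofReal_abs, ← ENNReal.ofReal_mul (abs_nonneg _), ← div_eq_mul_inv]
      _ = (∫⁻ ω, ‖y k ω‖ₑ ∂P) * ENNReal.ofReal ((k : ℝ)⁻¹) :=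
          lintegral_mul_const'' _ (hy k).enorm
      _ ≤ ENNReal.ofReal (M.toReal * a k) * ENNReal.ofReal ((k : ℝ)⁻¹) := by gcongr
      _ ≤ _ := by
          rw [← ENNReal.ofReal_mul (by positivity)]
          refine ENNReal.ofReal_le_ofReal ?_
          rw [mul_assoc, ← div_eq_mul_inv]
          gcongr
          linarith
  obtain ⟨C, hC, hsum⟩ := exists_sum_div_le hL hρ hρ1 ha
  have hbound : ∀ m n : ℕ, 1 ≤ n → m ≤ n →
      ∫⁻ ω, ENNReal.ofReal (1 / a n * ∑ k ∈ Finset.Icc 1 m, u k ω) ∂P ≤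
        ENNReal.ofReal (D * C * ((m : ℝ) / n) ^ (ρ / 2)) := by
    intro m n hn hmn
    refine (lintegral_mul_sum_le hu hu0 (hb0 n hn) (fun k hk =>
      mul_nonneg hD.le (div_nonneg (ha k hk).1.le (Nat.cast_nonneg k))) huD).trans ?_
    refine ENNReal.ofReal_le_ofReal ?_
    have han := (ha n hn).1
    rw [← Finset.mul_sum]
    calc 1 / a n * (D * ∑ k ∈ Finset.Icc 1 m, a k / k)
        ≤ 1 / a n * (D * (C * ((m : ℝ) / n) ^ (ρ / 2) * a n)) := by
          gcongr
          exact hsum m n hn hmn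
      _ = _ := by field_simp
  have hbound1 : ∀ n : ℕ, 1 ≤ n →
      ∫⁻ ω, ENNReal.ofReal (1 / a n * ∑ k ∈ Finset.Icc 1 n, u k ω) ∂P ≤
        ENNReal.ofReal (D * C) := by
    intro n hn
    have hn0 : (n : ℝ) ≠ 0 := by exact_mod_cast (Nat.one_le_iff_ne_zero.1 hn)
    have h1 := hbound n n hn le_rfl
    rwa [div_self hn0, Real.one_rpow, mul_one] at h1
  -- The unspecified versions `X' n` are replaced by explicit step paths, almost surely equal to
  -- them.
  have hXY' : TendstoInDistribution
      (fun n ω => SkorokhodSpace.step n fun k => 1 / a n * y k ω) atTop Y (fun _ => P) Q := by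
    refine hXY.congr (fun n => ?_) (ae_eq_refl _)
    filter_upwards [hX' n] with ω hω
    ext t
    rw [hω t, SkorokhodSpace.step_apply, one_div_mul_eq_div]
  have hlevel : ∀ j, ∀ᶠ n : ℕ in atTop, 1 / (n : ℝ) ≤ SkorokhodSpace.level j := fun j =>
    (tendsto_one_div_atTop_nhds_zero_nat (𝕜 := ℝ)).eventually
      (ge_mem_nhds (SkorokhodSpace.level_pos j))
  have hint : ∀ᵐ ω ∂Q, IntervalIntegrable (fun s => (Y ω).extend s * s⁻¹) volume 0 1 := by
    refine ae_intervalIntegrable_extend_mul_inv hXY' (M := D * C) fun j => ?_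
    filter_upwards [eventually_ge_atTop 1, hlevel j] with n hn hnj
    refine (lintegral_mono fun ω => ENNReal.ofReal_le_ofReal ?_).trans (hbound1 n hn)
    refine (integral_abs_extend_step_mul_le hn (SkorokhodSpace.level_pos j) hnj _).trans
      (le_of_eq ?_)
    rw [Finset.mul_sum]
    refine Finset.sum_congr rfl fun k _ => ?_
    rw [abs_mul, abs_of_nonneg (hb0 n hn), mul_div_assoc]
  have hXext : ∀ᵐ ω ∂Q, ∀ s ∈ Set.Icc (0 : ℝ) 1,
      (Y ω).extend s * s⁻¹ = X s.toNNReal ω / s := by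
    filter_upwards [hYX] with ω hω s hs
    have h1 := (Y ω).extend_coe ⟨s, hs⟩
    rw [div_eq_mul_inv, ← hω ⟨s, hs⟩, ← h1]
  refine ⟨?_, fun n ω => SkorokhodSpace.step n fun i =>
      1 / a n * ∑ k ∈ Finset.Icc 1 i, (f (S k ω / (k : ℝ)) - f μ),
    fun ω => SkorokhodSpace.singularPrimitive f' (Y ω), fun n => ae_of_all _ fun ω t => rfl, ?_, ?_⟩
  · filter_upwards [hint, hXext] with ω h1 h2
    refine h1.congr fun s hs => h2 s ?_
    rw [Set.uIoc_of_le zero_le_one] at hs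
    exact Set.Ioc_subset_Icc_self hs
  · filter_upwards [hint, hXext] with ω h1 h2 t
    rw [SkorokhodSpace.singularPrimitive_apply f' h1]
    congr 1
    refine intervalIntegral.integral_congr fun s hs => h2 s ?_
    rw [Set.uIcc_of_le t.2.1] at hs
    exact ⟨hs.1, hs.2.trans t.2.2⟩
  refine tendstoInDistribution_of_approx
    (V := fun j n ω => SkorokhodSpace.truncPrimitive f' j
      (SkorokhodSpace.step n fun k => 1 / a n * y k ω))
    (Z := fun j ω => SkorokhodSpace.truncPrimitive f' j (Y ω)) (fun n => ?_)
    (fun j => hXY'.continuous_comp (SkorokhodSpace.continuous_truncPrimitive f' j))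
    (SkorokhodSpace.tendstoInMeasure_truncPrimitive f' hXY'.aemeasurable_limit hint)
    fun δ hδ η hη => ?_
  · refine SkorokhodSpace.aemeasurable_step n fun i _ => AEMeasurable.const_mul ?_ _
    exact Finset.aemeasurable_fun_sum _ fun k hk =>
      (hfm k (Finset.mem_Icc.1 hk).1).sub_const _
  -- `η` may be infinite, so a finite `θ < η` is shared among three errors: remainder with Riemann
  -- error, block below the cut-off, boundary cell. Only the second needs `j` large; the other two
  -- vanish as `n → ∞`.
  obtain ⟨θ, hθ0, hθη⟩ := ENNReal.lt_iff_exists_nnreal_btwn.1 hη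
  have hθ : 0 < (θ : ℝ) := by exact_mod_cast hθ0
  have hδ3 : 0 < δ / 3 := by positivity
  have hθ3 : 0 < (θ : ℝ) / 3 := by positivity
  have hsmall : ∀ᶠ j in atTop,
      |f'| * (D * C * SkorokhodSpace.level j ^ (ρ / 2)) / (δ / 3) ≤ (θ : ℝ) / 3 := by
    have h1 := SkorokhodSpace.tendsto_level.rpow_const (p := ρ / 2) (Or.inr (half_pos hρ).le)
    rw [Real.zero_rpow (half_pos hρ).ne'] at h1
    have h2 := ((h1.const_mul (D * C)).const_mul |f'|).div_const (δ / 3)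
    simp only [mul_zero, zero_div] at h2
    exact h2.eventually (ge_mem_nhds hθ3)
  have hE1 := eventually_measure_weighted_sum_le hu hg hu0 hglim hb0 hb (mul_pos hD hC) hbound1
    hδ3 hθ3
  have hE3 := eventually_measure_le_of_ae_tendsto_zero (P := P)
    (Z := fun n ω => |f'| * (1 / a n * (1 + ∑ k ∈ Finset.Icc 1 n, max (u k ω - 1) 0)))
    (fun n => by fun_prop) (by
      filter_upwards [hulim] with ω hω
      have h1 := tendsto_mul_sum_Icc_of_eventually_eq_zero hb (c := fun k => max (u k ω - 1) 0)
        (by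
          filter_upwards [hω.eventually (ge_mem_nhds one_pos)] with k hk
          exact max_eq_right (by linarith))
      have h2 := (hb.add h1).const_mul |f'|
      simp only [add_zero, mul_zero] at h2
      refine h2.congr fun n => ?_
      ring) hδ3 (ENNReal.ofReal_pos.2 hθ3)
  filter_upwards [hsmall] with j hj
  filter_upwards [hE1, hE3, eventually_ge_atTop 1, hlevel j] with n h1 h3 hn hnj
  have hn0 : (0 : ℝ) < n := by exact_mod_cast hn
  have hl0 := SkorokhodSpace.level_pos j
  set m := ⌊(n : ℝ) * SkorokhodSpace.level j⌋₊ with hm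
  have hmn : m ≤ n := Nat.floor_le_of_le
    (mul_le_of_le_one_right hn0.le (SkorokhodSpace.level_le_one j))
  have h2 : P {ω | δ / 3 ≤ |f'| * (1 / a n * ∑ k ∈ Finset.Icc 1 m, u k ω)} ≤
      ENNReal.ofReal (θ / 3) := by
    refine (measure_le_ofReal_div (M := |f'| * (D * C * SkorokhodSpace.level j ^ (ρ / 2)))
      (by fun_prop) hδ3 ?_).trans (ENNReal.ofReal_le_ofReal hj)
    simp only [ENNReal.ofReal_mul (abs_nonneg f')]
    rw [lintegral_const_mul'' _ (by fun_prop)]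
    gcongr
    refine (hbound m n hn hmn).trans (ENNReal.ofReal_le_ofReal ?_)
    gcongr
    rw [div_le_iff₀ hn0, mul_comm]
    exact Nat.floor_le (by positivity)
  refine le_trans ?_ hθη.le
  rw [← ENNReal.ofReal_coe_nnreal, show (θ : ℝ) = θ / 3 + θ / 3 + θ / 3 by ring,
    ENNReal.ofReal_add (by positivity) hθ3.le, ENNReal.ofReal_add hθ3.le hθ3.le]
  refine le_trans ?_ (add_le_add (add_le_add h1 h2) h3)
  refine le_trans (measure_mono fun ω hω => ?_) ((measure_union_le _ _).trans
    (add_le_add (measure_union_le _ _) le_rfl))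
  by_contra hcon
  simp only [Set.mem_union, Set.mem_ofPred_eq, not_or, not_le] at hcon
  obtain ⟨⟨c1, c2⟩, c3⟩ := hcon
  have hdist := SkorokhodSpace.edist_step_sum_truncPrimitive_le hn j hnj (hb0 n hn) f'
    (fun k => y k ω) (fun k => r k ω)
  have hstep : (SkorokhodSpace.step n fun i =>
      1 / a n * ∑ k ∈ Finset.Icc 1 i, (f' * (y k ω / k) + r k ω)) =
      SkorokhodSpace.step n fun i =>
        1 / a n * ∑ k ∈ Finset.Icc 1 i, (f (S k ω / (k : ℝ)) - f μ) := by
    simp only [r, add_sub_cancel]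
  have hrg : ∑ k ∈ Finset.Icc 1 n, (|r k ω| + |f'| * (|y k ω| / k * (1 / k))) =
      ∑ k ∈ Finset.Icc 1 n, u k ω * (if k = 0 then 0 else g k) ω := by
    refine Finset.sum_congr rfl fun k hk => ?_
    have hk1 := (Finset.mem_Icc.1 hk).1
    rw [if_neg (Nat.one_le_iff_ne_zero.1 hk1)]
    change _ = u k ω * (|r k ω| / u k ω + |f'| * (1 / k))
    change |r k ω| + |f'| * (u k ω * (1 / k)) = _
    -- If `u k = 0`, the quotient in `g` is zero by convention and no longer recovers `r k`; but
    -- then `S k / k = μ`, so `r k` vanishes as well.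
    rcases eq_or_ne (u k ω) 0 with h0 | h0
    · have h4 := huk k hk1 ω
      rw [h0, eq_comm, abs_eq_zero] at h4
      have h5 : r k ω = 0 := by
        simp only [r]
        rw [hyk k hk1, h4, sub_eq_zero.1 h4]
        ring
      rw [h0, h5]
      simp
    · field_simp
  rw [hstep, hrg] at hdist
  refine (lt_of_le_of_lt hdist ((ENNReal.ofReal_lt_ofReal_iff hδ).2 ?_)).not_ge hω
  linarith

end StableFCLT

theorem theorem4p1 {Ω Ω' : Type*} [MeasurableSpace Ω] [MeasurableSpace Ω']
    (P : Measure Ω) [IsProbabilityMeasure P] (Q : Measure Ω') [IsProbabilityMeasure Q]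
    (α β s m : ℝ) (hα : 1 < α ∧ α ≤ 2) (hβ : -1 ≤ β ∧ β ≤ 1) (hs : 0 < s)
    (X : ℝ≥0 → Ω' → ℝ) (hX : StableFCLT.IsStableLevyProcess α β s m X Q)
    (S : ℕ → Ω → ℝ) (hS : ∀ k, AEMeasurable (S k) P) (μ : ℝ)
    (L : ℝ → ℝ) (hL : StableFCLT.SlowlyVarying L)
    (a : ℕ → ℝ) (ha : ∀ n : ℕ, 1 ≤ n → 0 < a n ∧ a n = (n : ℝ) ^ (1 / α) * L n)
    (hconv : StableFCLT.TendstoInDistributionD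
      (fun n t ω => (S ⌊(n : ℝ) * (t : ℝ)⌋₊ ω - (⌊(n : ℝ) * (t : ℝ)⌋₊ : ℝ) * μ) / a n) P
      (fun t ω => X (t : ℝ).toNNReal ω) Q)
    (hmean : (⨆ (n : ℕ) (_ : 1 ≤ n),
      (∫⁻ ω, ‖S n ω - (n : ℝ) * μ‖ₑ ∂P) / ENNReal.ofReal (a n)) < ∞)
    (hlln : ∀ᵐ ω ∂P, Tendsto (fun n : ℕ => S n ω / (n : ℝ)) atTop (𝓝 μ))
    (J : Set ℝ) (hJ : J.OrdConnected) (hμJ : μ ∈ J)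
    (hSJ : ∀ k : ℕ, 1 ≤ k → ∀ᵐ ω ∂P, S k ω / (k : ℝ) ∈ J)
    (f : ℝ → ℝ) (f' : ℝ) (hf : HasDerivWithinAt f f' J μ)
    (hfm : ∀ k : ℕ, 1 ≤ k → AEMeasurable (fun ω => f (S k ω / (k : ℝ))) P) :
    (∀ᵐ ω ∂Q, IntervalIntegrable (fun x : ℝ => X x.toNNReal ω / x) volume 0 1) ∧
    StableFCLT.TendstoInDistributionD
      (fun n t ω => (1 / a n) *
        ∑ k ∈ Finset.Icc 1 ⌊(n : ℝ) * (t : ℝ)⌋₊, (f (S k ω / (k : ℝ)) - f μ)) P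
      (fun t ω => f' * ∫ x in (0 : ℝ)..(t : ℝ), X x.toNNReal ω / x) Q := by
  have h0 : 0 < α := one_pos.trans hα.1
  exact StableFCLT.tendstoInDistributionD_sum P Q (one_div_pos.2 h0)
    ((div_le_one h0).2 hα.1.le) X S hS μ L hL a ha hconv hmean hlln J hSJ f f' hf hfm
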